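/- Let $k$ be a field of positive characteristic $p\neq 2$ and let $n\ge 1$. Let $$A_n(k)=k\langle x_1,\dots,x_{2n}\rangle/\big([x_i,x_j]=\delta_{i,j+n}-\delta_{i+n,j}\big)_{1\le i,j\le 2n}$$ be the $n$-th Weyl algebra and let $Z_n(k)=k[z_1,\dots,z_{2n}]$ be the polynomial ring, acting on $A_n(k)$ through $z_i\mapsto x_i^p$. This map identifies $Z_n(k)$ with the center $k[x_1^p,\dots,x_{2n}^p]$ of $A_n(k)$, and $A_n(k)$ is an Azumaya algebra over $Z_n(k)$. Put $\mathbb{A}^{2n}_k=\mathrm{Spec}(Z_n(k))$. For a commutative ring $R$, let $\mathrm{Br}(\mathrm{Spec}\,R)$ be the group of Azumaya $R$-algebras modulo the relation $A\sim B$ if and only if $A\otimes_R\mathrm{End}_R(V)\cong B\otimes_R\mathrm{End}_R(W)$ as $R$-algebras for some faithful finitely generated projective $R$-modules $V,W$, with product $[A]\cdot[B]=[A\otimes_R B]$. If $R$ is a $k$-algebra, the group $\mathrm{Aut}(\mathrm{Spec}\,R)$ of automorphisms of the $k$-scheme $\mathrm{Spec}\,R$ acts on $\mathrm{Br}(\mathrm{Spec}\,R)$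 by $\phi\cdot[A]=[\phi_*A]$, where $\phi_*A$ is the ring $A$ with the $R$-algebra structure $R\xrightarrow{\bar\phi}R\to A$ and $\bar\phi$ is the algebra automorphism dual to $\phi$; write $\mathrm{Aut}(\mathrm{Spec}\,R)_{[A]}$ for the stabilizer of $[A]$. For $c\in k^\times$ let $\omega(c)\in\mathrm{Aut}(\mathbb{A}^{2n}_k)$ be dual to the $k$-algebra automorphism of $Z_n(k)$ with $z_i\mapsto z_i$ for $i\le n$ and $z_i\mapsto c^{-1}z_i$ for $i>n$, and put formally $\omega(0)_*A_n(k)=M_{p^n}(Z_n(k))$. Then: 1. The map $k\to\mathrm{Br}(\mathbb{A}^{2n}_k)$, $c\mapsto[\omega(c)_*A_n(k)]$, is an injective group homomorphism from the additive group of $k$. 2. The map $k^\times\to\mathrm{Aut}(\mathbb{A}^{2n}_k)/\mathrm{Aut}(\mathbb{A}^{2n}_k)_{[A_n(k)]}$, $c\mapsto\omega(c)\cdot\mathrm{Aut}(\mathbb{A}^{2n}_k)_{[A_n(k)]}$, is injective. -/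

import Mathlib

open scoped TensorProduct

universe u

noncomputable section

/-! ### Endomorphism algebras of finitely generated projective modules -/

namespace BrauerAux

variable {R : Type*} [CommRing R]

/-- For finitely generated projective modules, `End V ⊗ End W → End (V ⊗ W)` is bijective. -/
theorem endTensorEnd_bijective (V W : Type*) [AddCommGroup V] [AddCommGroup W] [Module R V]
    [Module R W] [Module.Finite R V] [Module.Finite R W] [Module.Projective R V]
    [Module.Projective R W] :
    Function.Bijective (Module.endTensorEndAlgHom (R := R) (S := R) (A := R) (M := V) (N := W)) := by
  obtain ⟨a, s, i, -, -, hsi⟩ := Module.Finite.exists_comp_eq_id_of_projective R V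
  obtain ⟨b, t, j, -, -, htj⟩ := Module.Finite.exists_comp_eq_id_of_projective R W
  let F := Fin a → R
  let G := Fin b → R
  have hF : Function.Bijective
      (Module.endTensorEndAlgHom (R := R) (S := R) (A := R) (M := F) (N := G)) := by
    have h := (homTensorHomEquiv R F G F G).bijective
    convert h using 1
    ext x
    rw [homTensorHomEquiv_apply]
    rfl
  -- conjugation by the retractions
  let I₁ : Module.End R V →ₗ[R] Module.End R F :=
    { toFun := fun f => i ∘ₗ f ∘ₗ s
      map_add' := fun f g => by ext; simp
      map_smul' := fun r f => by ext; simp }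
  let S₁ : Module.End R F →ₗ[R] Module.End R V :=
    { toFun := fun f => s ∘ₗ f ∘ₗ i
      map_add' := fun f g => by ext; simp
      map_smul' := fun r f => by ext; simp }
  let I₂ : Module.End R W →ₗ[R] Module.End R G :=
    { toFun := fun f => j ∘ₗ f ∘ₗ t
      map_add' := fun f g => by ext; simp
      map_smul' := fun r f => by ext; simp }
  let S₂ : Module.End R G →ₗ[R] Module.End R W :=
    { toFun := fun f => t ∘ₗ f ∘ₗ j
      map_add' := fun f g => by ext; simp
      map_smul' := fun r f => by ext; simp }
  have hsi' : ∀ v, s (i v) = v := fun v => LinearMap.congr_fun hsi v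
  have htj' : ∀ v, t (j v) = v := fun v => LinearMap.congr_fun htj v
  have hSI₁ : S₁ ∘ₗ I₁ = LinearMap.id := by
    ext f v; simp [S₁, I₁, hsi']
  have hSI₂ : S₂ ∘ₗ I₂ = LinearMap.id := by
    ext f v; simp [S₂, I₂, htj']
  have hSI : ∀ x, TensorProduct.map S₁ S₂ (TensorProduct.map I₁ I₂ x) = x := by
    intro x
    rw [← LinearMap.comp_apply, ← TensorProduct.map_comp, hSI₁, hSI₂, TensorProduct.map_id]
    rfl
  have natI : ∀ x : Module.End R V ⊗[R] Module.End R W,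
      Module.endTensorEndAlgHom (R := R) (S := R) (A := R) (TensorProduct.map I₁ I₂ x)
        = TensorProduct.map i j ∘ₗ
          (Module.endTensorEndAlgHom (R := R) (S := R) (A := R) x) ∘ₗ TensorProduct.map s t := by
    intro x
    induction x with
    | zero => simp
    | add x y hx hy => simp only [map_add, hx, hy, LinearMap.add_comp, LinearMap.comp_add]
    | tmul f g =>
      apply TensorProduct.ext'
      intro v w
      rfl
  have natS : ∀ x : Module.End R F ⊗[R] Module.End R G,
      Module.endTensorEndAlgHom (R := R) (S := R) (A := R) (TensorProduct.map S₁ S₂ x)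
        = TensorProduct.map s t ∘ₗ
          (Module.endTensorEndAlgHom (R := R) (S := R) (A := R) x) ∘ₗ TensorProduct.map i j := by
    intro x
    induction x with
    | zero => simp
    | add x y hx hy => simp only [map_add, hx, hy, LinearMap.add_comp, LinearMap.comp_add]
    | tmul f g =>
      apply TensorProduct.ext'
      intro v w
      rfl
  constructor
  · intro x y hxy
    have h : TensorProduct.map I₁ I₂ x = TensorProduct.map I₁ I₂ y := by
      apply hF.1
      rw [natI, natI, hxy]
    rw [← hSI x, ← hSI y, h]
  · intro g
    obtain ⟨y, hy⟩ := hF.2 (TensorProduct.map i j ∘ₗ g ∘ₗ TensorProduct.map s t)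
    refine ⟨TensorProduct.map S₁ S₂ y, ?_⟩
    rw [natS, hy]
    apply TensorProduct.ext'
    intro v w
    have key : ∀ z : V ⊗[R] W, TensorProduct.map s t (TensorProduct.map i j z) = z := by
      intro z
      rw [← LinearMap.comp_apply, ← TensorProduct.map_comp, hsi, htj, TensorProduct.map_id]
      rfl
    simp only [LinearMap.comp_apply, key]

/-- `End V ⊗ End W ≃ End (V ⊗ W)` for finitely generated projective modules. -/
def endTensorEnd (V W : Type*) [AddCommGroup V] [AddCommGroup W] [Module R V]
    [Module R W] [Module.Finite R V] [Module.Finite R W] [Module.Projective R V]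
    [Module.Projective R W] :
    Module.End R V ⊗[R] Module.End R W ≃ₐ[R] Module.End R (V ⊗[R] W) :=
  AlgEquiv.ofBijective Module.endTensorEndAlgHom (endTensorEnd_bijective V W)

/-- A faithful finitely generated projective module is a generator: its trace ideal is `R`. -/
theorem exists_trace_eq_one (V : Type*) [AddCommGroup V] [Module R V] [Module.Finite R V]
    [Module.Projective R V] [FaithfulSMul R V] :
    (1 : R) ∈ Ideal.span {r : R | ∃ (f : V →ₗ[R] R) (v : V), f v = r} := by
  set T : Ideal R := Ideal.span {r : R | ∃ (f : V →ₗ[R] R) (v : V), f v = r} with hT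
  obtain ⟨a, s, i, -, -, hsi⟩ := Module.Finite.exists_comp_eq_id_of_projective R V
  have hle : (⊤ : Submodule R V) ≤ T • (⊤ : Submodule R V) := by
    intro v _
    have hv : v = ∑ l, (i v l) • s (Pi.single l 1) := by
      conv_lhs => rw [← LinearMap.id_apply (R := R) v, ← hsi, LinearMap.comp_apply,
        pi_eq_sum_univ' (i v)]
      simp only [map_sum, map_smul]
    rw [hv]
    refine Submodule.sum_mem _ fun l _ => Submodule.smul_mem_smul ?_ trivial
    exact Ideal.subset_span ⟨(LinearMap.proj l) ∘ₗ i, v, rfl⟩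
  obtain ⟨r, hr, hr0⟩ := Submodule.exists_sub_one_mem_and_smul_eq_zero_of_fg_of_le_smul T
    (⊤ : Submodule R V) Module.Finite.fg_top hle
  have : r = 0 := by
    apply FaithfulSMul.eq_of_smul_eq_smul (α := V)
    intro v
    rw [hr0 v trivial, zero_smul]
  rw [this, zero_sub] at hr
  simpa using T.neg_mem hr

/-- The tensor product of faithful finitely generated projective modules is faithful. -/
theorem faithfulSMul_tensor (V W : Type*) [AddCommGroup V] [AddCommGroup W] [Module R V]
    [Module R W] [Module.Finite R V] [Module.Projective R V] [FaithfulSMul R V]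
    [FaithfulSMul R W] : FaithfulSMul R (V ⊗[R] W) := by
  constructor
  intro r r' h
  apply FaithfulSMul.eq_of_smul_eq_smul (α := W)
  intro w
  have key : ∀ x ∈ Ideal.span {r : R | ∃ (f : V →ₗ[R] R) (v : V), f v = r},
      x • ((r - r') • w) = 0 := by
    intro x hx
    induction hx using Submodule.span_induction with
    | mem x hx =>
      obtain ⟨f, v, rfl⟩ := hx
      have h1 : (r - r') • (v ⊗ₜ[R] w) = 0 := by rw [sub_smul, h, sub_self]
      have h2 := congrArg ((TensorProduct.lid R W).toLinearMap ∘ₗ TensorProduct.map f LinearMap.id) h1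
      simp only [map_smul, map_zero, LinearMap.comp_apply, TensorProduct.map_tmul,
        LinearEquiv.coe_coe, TensorProduct.lid_tmul, LinearMap.id_apply] at h2
      rw [smul_comm]; exact h2
    | zero => simp
    | add x y _ _ hx hy => rw [add_smul, hx, hy, add_zero]
    | smul a x _ hx => rw [smul_eq_mul, mul_smul, hx, smul_zero]
  have := key 1 (exists_trace_eq_one V)
  rw [one_smul, sub_smul, sub_eq_zero] at this
  exact this

end BrauerAux

/-! ### The Brauer group of a commutative ring -/

/-- An Azumaya algebra over `R`: a finitely generated projective faithful `R`-algebra `A` such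
that the action map `A ⊗ Aᵒᵖ → End_R A` is an isomorphism. -/
structure AzumayaAlgebra (R : Type u) [CommRing R] : Type (u + 1) where
  carrier : Type u
  [ring : Ring carrier]
  [algebra : Algebra R carrier]
  [isAzumaya : IsAzumaya R carrier]

namespace AzumayaAlgebra

attribute [instance] ring algebra isAzumaya

instance (R : Type u) [CommRing R] : CoeSort (AzumayaAlgebra R) (Type u) := ⟨carrier⟩

end AzumayaAlgebra

/-- Brauer equivalence of `R`-algebras: `A ⊗ End V ≅ B ⊗ End W` for some faithful (that is,
everywhere of positive rank) finitely generated projective `R`-modules `V` and `W`. -/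
def BrauerEquiv (R : Type u) [CommRing R] (A B : Type u) [Ring A] [Ring B] [Algebra R A]
    [Algebra R B] : Prop :=
  ∃ (V W : Type u) (_ : AddCommGroup V) (_ : AddCommGroup W) (_ : Module R V) (_ : Module R W),
    (Module.Finite R V ∧ Module.Projective R V ∧ FaithfulSMul R V) ∧
    (Module.Finite R W ∧ Module.Projective R W ∧ FaithfulSMul R W) ∧
    Nonempty (A ⊗[R] Module.End R V ≃ₐ[R] B ⊗[R] Module.End R W)

namespace BrauerEquiv

open BrauerAux

variable {R : Type u} [CommRing R]

section

variable {A B C D : Type u} [Ring A] [Ring B] [Ring C] [Ring D] [Algebra R A] [Algebra R B]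
  [Algebra R C] [Algebra R D]

theorem of_algEquiv (e : A ≃ₐ[R] B) : BrauerEquiv R A B :=
  ⟨R, R, inferInstance, inferInstance, inferInstance, inferInstance,
    ⟨inferInstance, inferInstance, inferInstance⟩, ⟨inferInstance, inferInstance, inferInstance⟩,
    ⟨Algebra.TensorProduct.congr e AlgEquiv.refl⟩⟩

theorem refl : BrauerEquiv R A A := of_algEquiv AlgEquiv.refl

theorem symm (h : BrauerEquiv R A B) : BrauerEquiv R B A := by
  obtain ⟨V, W, _, _, _, _, hV, hW, ⟨e⟩⟩ := h
  exact ⟨W, V, _, _, _, _, hW, hV, ⟨e.symm⟩⟩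

theorem trans (h : BrauerEquiv R A B) (h' : BrauerEquiv R B C) : BrauerEquiv R A C := by
  obtain ⟨V, W, _, _, _, _, ⟨_, _, _⟩, ⟨_, _, _⟩, ⟨e⟩⟩ := h
  obtain ⟨V', W', _, _, _, _, ⟨_, _, _⟩, ⟨_, _, _⟩, ⟨e'⟩⟩ := h'
  refine ⟨V ⊗[R] V', W' ⊗[R] W, inferInstance, inferInstance, inferInstance, inferInstance,
    ⟨inferInstance, inferInstance, faithfulSMul_tensor V V'⟩,
    ⟨inferInstance, inferInstance, faithfulSMul_tensor W' W⟩, ⟨?_⟩⟩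
  let e₁ : A ⊗[R] Module.End R (V ⊗[R] V') ≃ₐ[R]
      (A ⊗[R] Module.End R V) ⊗[R] Module.End R V' :=
    (Algebra.TensorProduct.congr AlgEquiv.refl (endTensorEnd V V').symm).trans
      (Algebra.TensorProduct.assoc R R R A _ _).symm
  let e₂ : (A ⊗[R] Module.End R V) ⊗[R] Module.End R V' ≃ₐ[R]
      (B ⊗[R] Module.End R W) ⊗[R] Module.End R V' :=
    Algebra.TensorProduct.congr e AlgEquiv.refl
  let e₃ : (B ⊗[R] Module.End R W) ⊗[R] Module.End R V' ≃ₐ[R]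
      (B ⊗[R] Module.End R V') ⊗[R] Module.End R W :=
    ((Algebra.TensorProduct.assoc R R R B _ _).trans
      (Algebra.TensorProduct.congr AlgEquiv.refl (Algebra.TensorProduct.comm R _ _))).trans
      (Algebra.TensorProduct.assoc R R R B _ _).symm
  let e₄ : (B ⊗[R] Module.End R V') ⊗[R] Module.End R W ≃ₐ[R]
      (C ⊗[R] Module.End R W') ⊗[R] Module.End R W :=
    Algebra.TensorProduct.congr e' AlgEquiv.refl
  let e₅ : (C ⊗[R] Module.End R W') ⊗[R] Module.End R W ≃ₐ[R]
      C ⊗[R] Module.End R (W' ⊗[R] W) :=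
    (Algebra.TensorProduct.assoc R R R C _ _).trans
      (Algebra.TensorProduct.congr AlgEquiv.refl (endTensorEnd W' W))
  exact e₁.trans (e₂.trans (e₃.trans (e₄.trans e₅)))

theorem tensor (h : BrauerEquiv R A B) (h' : BrauerEquiv R C D) :
    BrauerEquiv R (A ⊗[R] C) (B ⊗[R] D) := by
  obtain ⟨V, W, _, _, _, _, ⟨_, _, _⟩, ⟨_, _, _⟩, ⟨e⟩⟩ := h
  obtain ⟨V', W', _, _, _, _, ⟨_, _, _⟩, ⟨_, _, _⟩, ⟨e'⟩⟩ := h'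
  refine ⟨V ⊗[R] V', W ⊗[R] W', inferInstance, inferInstance, inferInstance, inferInstance,
    ⟨inferInstance, inferInstance, faithfulSMul_tensor V V'⟩,
    ⟨inferInstance, inferInstance, faithfulSMul_tensor W W'⟩, ⟨?_⟩⟩
  let e₁ : (A ⊗[R] C) ⊗[R] Module.End R (V ⊗[R] V') ≃ₐ[R]
      (A ⊗[R] Module.End R V) ⊗[R] (C ⊗[R] Module.End R V') :=
    (Algebra.TensorProduct.congr AlgEquiv.refl (endTensorEnd V V').symm).trans
      (Algebra.TensorProduct.tensorTensorTensorComm R R R R A C _ _)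
  let e₂ : (B ⊗[R] D) ⊗[R] Module.End R (W ⊗[R] W') ≃ₐ[R]
      (B ⊗[R] Module.End R W) ⊗[R] (D ⊗[R] Module.End R W') :=
    (Algebra.TensorProduct.congr AlgEquiv.refl (endTensorEnd W W').symm).trans
      (Algebra.TensorProduct.tensorTensorTensorComm R R R R B D _ _)
  exact e₁.trans ((Algebra.TensorProduct.congr e e').trans e₂.symm)

end

end BrauerEquiv

namespace AzumayaAlgebra

open BrauerAux MulOpposite

variable {R : Type u} [CommRing R]

/-- The tensor product of Azumaya algebras is Azumaya. -/
theorem isAzumaya_tensor (A B : Type u) [Ring A] [Ring B] [Algebra R A] [Algebra R B]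
    [IsAzumaya R A] [IsAzumaya R B] : IsAzumaya R (A ⊗[R] B) := by
  have := faithfulSMul_tensor (R := R) A B
  constructor
  let e : (A ⊗[R] B) ⊗[R] (A ⊗[R] B)ᵐᵒᵖ ≃ₐ[R] Module.End R (A ⊗[R] B) :=
    ((Algebra.TensorProduct.congr AlgEquiv.refl
      (Algebra.TensorProduct.opAlgEquiv R R A B).symm).trans
      (Algebra.TensorProduct.tensorTensorTensorComm R R R R A B Aᵐᵒᵖ Bᵐᵒᵖ)).trans
      ((Algebra.TensorProduct.congr
        (AlgEquiv.ofBijective (AlgHom.mulLeftRight R A) IsAzumaya.bij)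
        (AlgEquiv.ofBijective (AlgHom.mulLeftRight R B) IsAzumaya.bij)).trans
        (endTensorEnd A B))
  have he : AlgHom.mulLeftRight R (A ⊗[R] B) = e.toAlgHom := by
    apply AlgHom.toLinearMap_injective
    apply TensorProduct.ext'
    intro x y
    obtain ⟨y, rfl⟩ := op_surjective y
    apply LinearMap.ext
    intro z
    simp only [AlgHom.toLinearMap_apply]
    induction x with
    | zero => simp
    | add x x' hx hx' => simp only [TensorProduct.add_tmul, map_add, LinearMap.add_apply, hx, hx']
    | tmul a b =>
      induction y with
      | zero => simp
      | add y y' hy hy' =>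
        simp only [op_add, TensorProduct.tmul_add, map_add, LinearMap.add_apply, hy, hy']
      | tmul c d =>
        induction z with
        | zero => simp
        | add z z' hz hz' => simp only [map_add, hz, hz']
        | tmul v w =>
          simp [e, endTensorEnd, Module.endTensorEndAlgHom_apply, AlgHom.mulLeftRight_apply]
  rw [he]
  exact e.bijective

/-- The opposite of an Azumaya algebra is Azumaya. -/
theorem isAzumaya_op (A : Type u) [Ring A] [Algebra R A] [IsAzumaya R A] :
    IsAzumaya R Aᵐᵒᵖ := by
  have : Module.Projective R Aᵐᵒᵖ := .of_equiv (opLinearEquiv R (M := A))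
  have : Module.Finite R Aᵐᵒᵖ := .equiv (opLinearEquiv R (M := A))
  have : FaithfulSMul R Aᵐᵒᵖ :=
    .of_injective (opLinearEquiv R (M := A)) (opLinearEquiv R (M := A)).injective
  constructor
  let e : Aᵐᵒᵖ ⊗[R] Aᵐᵒᵖᵐᵒᵖ ≃ₐ[R] Module.End R Aᵐᵒᵖ :=
    (Algebra.TensorProduct.comm R _ _).trans
      ((Algebra.TensorProduct.congr (AlgEquiv.opOp R A).symm AlgEquiv.refl).trans
      ((AlgEquiv.ofBijective (AlgHom.mulLeftRight R A) IsAzumaya.bij).trans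
        ((opLinearEquiv R (M := A)).conjAlgEquiv R)))
  have he : AlgHom.mulLeftRight R Aᵐᵒᵖ = e.toAlgHom := by
    ext <;> simp [e]
  rw [he]
  exact e.bijective

end AzumayaAlgebra

namespace AzumayaAlgebra

variable {R : Type u} [CommRing R]

/-- Brauer equivalence as a setoid on Azumaya algebras. -/
instance brauerSetoid (R : Type u) [CommRing R] : Setoid (AzumayaAlgebra R) where
  r A B := BrauerEquiv R A B
  iseqv := ⟨fun _ => BrauerEquiv.refl, BrauerEquiv.symm, BrauerEquiv.trans⟩

/-- The tensor product of two Azumaya algebras. -/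
def tensor (A B : AzumayaAlgebra R) : AzumayaAlgebra R where
  carrier := A ⊗[R] B
  isAzumaya := isAzumaya_tensor A B

/-- The opposite of an Azumaya algebra. -/
def opposite (A : AzumayaAlgebra R) : AzumayaAlgebra R where
  carrier := Aᵐᵒᵖ
  isAzumaya := isAzumaya_op A

/-- The trivial Azumaya algebra `R`. -/
def trivial (R : Type u) [CommRing R] : AzumayaAlgebra R where
  carrier := R

end AzumayaAlgebra

/-- The Brauer group `Br(Spec R)`: Azumaya algebras over `R` up to Brauer equivalence. -/
def Br (R : Type u) [CommRing R] : Type (u + 1) :=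
  Quotient (AzumayaAlgebra.brauerSetoid R)

namespace Br

open AzumayaAlgebra BrauerAux

variable {R : Type u} [CommRing R]

/-- The Brauer class `[A]` of an Azumaya algebra `A`. -/
def mk (R : Type u) [CommRing R] (A : Type u) [Ring A] [Algebra R A] (hA : IsAzumaya R A) :
    Br R :=
  Quotient.mk (AzumayaAlgebra.brauerSetoid R) (AzumayaAlgebra.mk A)

theorem mk_eq_mk_iff {A B : Type u} [Ring A] [Algebra R A] [Ring B] [Algebra R B]
    (hA : IsAzumaya R A) (hB : IsAzumaya R B) : mk R A hA = mk R B hB ↔ BrauerEquiv R A B :=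
  Quotient.eq

theorem ind {P : Br R → Prop}
    (h : ∀ (A : Type u) [Ring A] [Algebra R A] (hA : IsAzumaya R A), P (mk R A hA)) (x : Br R) :
    P x :=
  Quotient.ind (fun A => h A.carrier A.isAzumaya) x

instance : Mul (Br R) where
  mul := Quotient.map₂ AzumayaAlgebra.tensor fun _ _ h _ _ h' => BrauerEquiv.tensor h h'

instance : One (Br R) where
  one := Quotient.mk _ (AzumayaAlgebra.trivial R)

theorem op_tensor_equiv (A : Type u) [Ring A] [Algebra R A] [IsAzumaya R A] :
    BrauerEquiv R (Aᵐᵒᵖ ⊗[R] A) R := by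
  refine ⟨R, A, inferInstance, inferInstance, inferInstance, inferInstance,
    ⟨inferInstance, inferInstance, inferInstance⟩, ⟨inferInstance, inferInstance, inferInstance⟩,
    ⟨?_⟩⟩
  let e : Aᵐᵒᵖ ⊗[R] A ≃ₐ[R] Module.End R A :=
    (Algebra.TensorProduct.comm R _ _).trans
      (AlgEquiv.ofBijective (AlgHom.mulLeftRight R A) IsAzumaya.bij)
  let e' : Module.End R R ≃ₐ[R] R :=
    (AlgEquiv.moduleEndSelf R (A := R)).symm.trans (AlgEquiv.toOpposite R R).symm
  exact (Algebra.TensorProduct.congr e e').trans (Algebra.TensorProduct.comm R _ _)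

theorem opposite_equiv {A B : AzumayaAlgebra R} (h : BrauerEquiv R A B) :
    BrauerEquiv R A.opposite B.opposite := by
  change BrauerEquiv R Aᵐᵒᵖ Bᵐᵒᵖ
  have h₁ : BrauerEquiv R (Aᵐᵒᵖ ⊗[R] (Bᵐᵒᵖ ⊗[R] B)) (Aᵐᵒᵖ) :=
    (BrauerEquiv.tensor (R := R) .refl (op_tensor_equiv B)).trans
      (.of_algEquiv (Algebra.TensorProduct.rid R R _))
  have h₂ : BrauerEquiv R (Aᵐᵒᵖ ⊗[R] (Bᵐᵒᵖ ⊗[R] B)) (Aᵐᵒᵖ ⊗[R] (Bᵐᵒᵖ ⊗[R] A)) :=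
    .tensor .refl (.tensor .refl h.symm)
  have h₃ : BrauerEquiv R (Aᵐᵒᵖ ⊗[R] (Bᵐᵒᵖ ⊗[R] A)) ((Aᵐᵒᵖ ⊗[R] A) ⊗[R] Bᵐᵒᵖ) :=
    .of_algEquiv ((Algebra.TensorProduct.congr AlgEquiv.refl
      (Algebra.TensorProduct.comm R _ _)).trans (Algebra.TensorProduct.assoc R R R _ _ _).symm)
  have h₄ : BrauerEquiv R ((Aᵐᵒᵖ ⊗[R] A) ⊗[R] Bᵐᵒᵖ) Bᵐᵒᵖ :=
    (BrauerEquiv.tensor (R := R) (op_tensor_equiv A) .refl).trans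
      (.of_algEquiv (Algebra.TensorProduct.lid R _))
  exact h₁.symm.trans (h₂.trans (h₃.trans h₄))

instance : Inv (Br R) where
  inv := Quotient.map AzumayaAlgebra.opposite fun _ _ h => opposite_equiv h

theorem mk_mul_mk {A B : Type u} [Ring A] [Algebra R A] [Ring B] [Algebra R B]
    (hA : IsAzumaya R A) (hB : IsAzumaya R B) :
    mk R A hA * mk R B hB = mk R (A ⊗[R] B) (isAzumaya_tensor A B) :=
  rfl

theorem one_eq : (1 : Br R) = mk R R (IsAzumaya.id R) :=
  rfl

/-- `Br(Spec R)` is an abelian group with `[A] * [B] = [A ⊗ B]` and `[A]⁻¹ = [Aᵒᵖ]`. -/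
instance : CommGroup (Br R) where
  mul_assoc x y z := by
    induction x using ind; induction y using ind; induction z using ind
    exact Quotient.sound (BrauerEquiv.of_algEquiv (Algebra.TensorProduct.assoc R R R _ _ _))
  one_mul x := by
    induction x using ind
    exact Quotient.sound (BrauerEquiv.of_algEquiv (Algebra.TensorProduct.lid R _))
  mul_one x := by
    induction x using ind
    exact Quotient.sound (BrauerEquiv.of_algEquiv (Algebra.TensorProduct.rid R R _))
  mul_comm x y := by
    induction x using ind; induction y using ind
    exact Quotient.sound (BrauerEquiv.of_algEquiv (Algebra.TensorProduct.comm R _ _))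
  inv_mul_cancel x := by
    induction x using ind with
    | h A hA =>
    exact Quotient.sound (op_tensor_equiv A)

end Br

/-! ### Pushforward of algebras along automorphisms -/

/-- The ring `A` with the new `R`-algebra structure `R → R → A`, the first map being `σ`. -/
def Twist {R : Type u} [CommRing R] (_σ : R ≃+* R) (A : Type u) : Type u := A

namespace Twist

open BrauerAux

variable {R : Type u} [CommRing R] (σ : R ≃+* R)

instance (A : Type u) [h : Ring A] : Ring (Twist σ A) := h

instance (A : Type u) [Ring A] [Algebra R A] : Algebra R (Twist σ A) :=
  Algebra.compHom A (σ : R →+* R)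

/-- The identity map `A → Twist σ A` as a ring isomorphism. -/
def of (A : Type u) [Ring A] : A ≃+* Twist σ A := RingEquiv.refl A

variable {σ}

theorem algebraMap_apply {A : Type u} [Ring A] [Algebra R A] (r : R) :
    algebraMap R (Twist σ A) r = of σ A (algebraMap R A (σ r)) :=
  rfl

theorem of_smul {A : Type u} [Ring A] [Algebra R A] (r : R) (a : A) :
    of σ A (r • a) = σ.symm r • of σ A a := by
  rw [Algebra.smul_def, Algebra.smul_def, algebraMap_apply, σ.apply_symm_apply, map_mul]

theorem smul_of {A : Type u} [Ring A] [Algebra R A] (r : R) (a : A) :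
    r • of σ A a = of σ A (σ r • a) := by
  rw [of_smul, σ.symm_apply_apply]

/-- Twisting an algebra isomorphism. -/
def congr {A B : Type u} [Ring A] [Algebra R A] [Ring B] [Algebra R B] (e : A ≃ₐ[R] B) :
    Twist σ A ≃ₐ[R] Twist σ B :=
  AlgEquiv.ofRingEquiv (f := ((of σ A).symm.trans e.toRingEquiv).trans (of σ B)) (by
    intro r
    simp [algebraMap_apply])

/-- A ring isomorphism semilinear over `σ` yields an algebra isomorphism from the twist. -/
def algEquivOfRingEquiv {A B : Type u} [Ring A] [Algebra R A] [Ring B] [Algebra R B]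
    (e : A ≃+* B) (he : ∀ r, e (algebraMap R A (σ r)) = algebraMap R B r) :
    Twist σ A ≃ₐ[R] B :=
  AlgEquiv.ofRingEquiv (f := (of σ A).symm.trans e) (by
    intro r
    simpa [algebraMap_apply] using he r)

variable (σ)

/-- Twisting commutes with tensor products. -/
def tensorEquiv (A B : Type u) [Ring A] [Algebra R A] [Ring B] [Algebra R B] :
    Twist σ A ⊗[R] Twist σ B ≃ₐ[R] Twist σ (A ⊗[R] B) := by
  let f : Twist σ A ⊗[R] Twist σ B →ₐ[R] Twist σ (A ⊗[R] B) :=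
    Algebra.TensorProduct.lift
      { toRingHom := (of σ (A ⊗[R] B) : A ⊗[R] B →+* _).comp
          ((Algebra.TensorProduct.includeLeft : A →ₐ[R] A ⊗[R] B).toRingHom.comp
            ((of σ A).symm : Twist σ A →+* A))
        commutes' := fun r => rfl }
      { toRingHom := (of σ (A ⊗[R] B) : A ⊗[R] B →+* _).comp
          ((Algebra.TensorProduct.includeRight : B →ₐ[R] A ⊗[R] B).toRingHom.comp
            ((of σ B).symm : Twist σ B →+* B))
        commutes' := fun r => by
          change of σ _ (Algebra.TensorProduct.includeRight (algebraMap R B (σ r))) = _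
          rw [AlgHom.commutes]; rfl }
      (fun a b => by
        obtain ⟨a, rfl⟩ := (of σ A).surjective a
        obtain ⟨b, rfl⟩ := (of σ B).surjective b
        change of σ (A ⊗[R] B) (a ⊗ₜ[R] (1 : B)) * of σ (A ⊗[R] B) ((1 : A) ⊗ₜ[R] b)
          = of σ (A ⊗[R] B) ((1 : A) ⊗ₜ[R] b) * of σ (A ⊗[R] B) (a ⊗ₜ[R] (1 : B))
        rw [← map_mul, ← map_mul]
        simp)
  have hf : ∀ (a : A) (b : B), f (of σ A a ⊗ₜ[R] of σ B b) = of σ (A ⊗[R] B) (a ⊗ₜ[R] b) := by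
    intro a b
    change of σ (A ⊗[R] B) (a ⊗ₜ[R] (1 : B)) * of σ (A ⊗[R] B) ((1 : A) ⊗ₜ[R] b) = _
    rw [← map_mul]; simp
  let g : A ⊗[R] B →+ Twist σ A ⊗[R] Twist σ B :=
    TensorProduct.liftAddHom
      { toFun := fun a =>
          { toFun := fun b => of σ A a ⊗ₜ[R] of σ B b
            map_zero' := by simp
            map_add' := fun b b' => by simp [TensorProduct.tmul_add] }
        map_zero' := by ext; simp
        map_add' := fun a a' => by ext; simp [TensorProduct.add_tmul] }
      (fun r a b => by
        change of σ A (r • a) ⊗ₜ[R] of σ B b = of σ A a ⊗ₜ[R] of σ B (r • b)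
        rw [of_smul, of_smul, TensorProduct.smul_tmul])
  have hg : ∀ (a : A) (b : B), g (a ⊗ₜ[R] b) = of σ A a ⊗ₜ[R] of σ B b := fun a b => rfl
  refine AlgEquiv.ofBijective f ⟨?_, ?_⟩
  · refine Function.LeftInverse.injective (g := fun x => g ((of σ (A ⊗[R] B)).symm x)) ?_
    intro x
    induction x with
    | zero => simp
    | add x y hx hy => simp only [map_add, hx, hy]
    | tmul a b =>
      obtain ⟨a, rfl⟩ := (of σ A).surjective a
      obtain ⟨b, rfl⟩ := (of σ B).surjective b
      change g ((of σ (A ⊗[R] B)).symm (f (of σ A a ⊗ₜ[R] of σ B b))) = _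
      rw [hf, RingEquiv.symm_apply_apply]
      exact hg a b
  · intro x
    obtain ⟨x, rfl⟩ := (of σ (A ⊗[R] B)).surjective x
    refine ⟨g x, ?_⟩
    induction x with
    | zero => simp
    | add x y hx hy => simp only [map_add, hx, hy]
    | tmul a b => rw [hg, hf]

theorem tensorEquiv_tmul (A B : Type u) [Ring A] [Algebra R A] [Ring B] [Algebra R B]
    (a : A) (b : B) : tensorEquiv σ A B (of σ A a ⊗ₜ[R] of σ B b) = of σ _ (a ⊗ₜ[R] b) := by
  change of σ (A ⊗[R] B) (a ⊗ₜ[R] (1 : B)) * of σ (A ⊗[R] B) ((1 : A) ⊗ₜ[R] b) = _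
  rw [← map_mul]; simp

/-- The module `V` with scalars twisted by `σ`. -/
def TwistMod {R : Type u} [CommRing R] (_σ : R ≃+* R) (V : Type u) : Type u := V

instance (V : Type u) [h : AddCommGroup V] : AddCommGroup (TwistMod σ V) := h

instance (V : Type u) [AddCommGroup V] [Module R V] : Module R (TwistMod σ V) :=
  Module.compHom V (σ : R →+* R)

/-- The identity `V → TwistMod σ V` as a semilinear equivalence. -/
def modOf (V : Type u) [AddCommGroup V] [Module R V] :
    letI := RingHomInvPair.of_ringEquiv σ.symm
    letI := RingHomInvPair.symm (σ.symm : R →+* R) (σ.symm.symm : R →+* R)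
    V ≃ₛₗ[(σ.symm : R →+* R)] TwistMod σ V :=
  letI := RingHomInvPair.of_ringEquiv σ.symm
  letI := RingHomInvPair.symm (σ.symm : R →+* R) (σ.symm.symm : R →+* R)
  { AddEquiv.refl V with
    map_smul' := fun r v => by
      change r • v = σ (σ.symm r) • v
      rw [σ.apply_symm_apply] }

/-- The identity `V → TwistMod σ V` as an additive equivalence. -/
def toMod (V : Type u) [AddCommGroup V] : V ≃+ TwistMod σ V := AddEquiv.refl V

theorem smul_toMod {V : Type u} [AddCommGroup V] [Module R V] (r : R) (v : V) :
    r • toMod σ V v = toMod σ V (σ r • v) := rfl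

theorem projective_mod (V : Type u) [AddCommGroup V] [Module R V] [Module.Projective R V] :
    Module.Projective R (TwistMod σ V) :=
  letI := RingHomInvPair.of_ringEquiv σ.symm
  letI := RingHomInvPair.symm (σ.symm : R →+* R) (σ.symm.symm : R →+* R)
  Module.Projective.of_equiv (modOf σ V)

theorem finite_mod (V : Type u) [AddCommGroup V] [Module R V] [Module.Finite R V] :
    Module.Finite R (TwistMod σ V) :=
  letI := RingHomInvPair.of_ringEquiv σ.symm
  letI := RingHomInvPair.symm (σ.symm : R →+* R) (σ.symm.symm : R →+* R)
  Module.Finite.of_surjective (modOf σ V).toLinearMap (modOf σ V).surjective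

theorem faithful_mod (V : Type u) [AddCommGroup V] [Module R V] [h : FaithfulSMul R V] :
    FaithfulSMul R (TwistMod σ V) := by
  constructor
  intro r r' hr
  exact σ.injective (h.eq_of_smul_eq_smul fun v => hr v)

/-- Twisting commutes with endomorphism algebras. -/
def endEquiv (V : Type u) [AddCommGroup V] [Module R V] :
    Twist σ (Module.End R V) ≃ₐ[R] Module.End R (TwistMod σ V) :=
  algEquivOfRingEquiv
    { toFun := fun f =>
        { toFun := fun v => toMod σ V (f ((toMod σ V).symm v))
          map_add' := fun v w => by simp only [map_add]
          map_smul' := fun r v => f.map_smul (σ r) ((toMod σ V).symm v) }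
      invFun := fun f =>
        { toFun := fun v => (toMod σ V).symm (f (toMod σ V v))
          map_add' := fun v w => by simp only [map_add]
          map_smul' := fun r v => by
            have h := f.map_smul (σ.symm r) (toMod σ V v)
            rw [smul_toMod, σ.apply_symm_apply] at h
            rw [h]
            obtain ⟨w, hw⟩ := (toMod σ V).surjective (f (toMod σ V v))
            rw [← hw, smul_toMod, σ.apply_symm_apply, AddEquiv.symm_apply_apply,
              AddEquiv.symm_apply_apply, RingHom.id_apply] }
      left_inv := fun f => rfl
      right_inv := fun f => rfl
      map_mul' := fun f g => rfl
      map_add' := fun f g => rfl }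
    (fun r => rfl)

theorem brauerEquiv {A B : Type u} [Ring A] [Algebra R A] [Ring B] [Algebra R B]
    (h : BrauerEquiv R A B) : BrauerEquiv R (Twist σ A) (Twist σ B) := by
  obtain ⟨V, W, _, _, _, _, ⟨_, _, _⟩, ⟨_, _, _⟩, ⟨e⟩⟩ := h
  refine ⟨TwistMod σ V, TwistMod σ W, inferInstance, inferInstance, inferInstance, inferInstance,
    ⟨finite_mod σ V, projective_mod σ V, faithful_mod σ V⟩,
    ⟨finite_mod σ W, projective_mod σ W, faithful_mod σ W⟩, ⟨?_⟩⟩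
  let e₁ : Twist σ A ⊗[R] Module.End R (TwistMod σ V) ≃ₐ[R] Twist σ (A ⊗[R] Module.End R V) :=
    (Algebra.TensorProduct.congr AlgEquiv.refl (endEquiv σ V).symm).trans (tensorEquiv σ _ _)
  let e₂ : Twist σ B ⊗[R] Module.End R (TwistMod σ W) ≃ₐ[R] Twist σ (B ⊗[R] Module.End R W) :=
    (Algebra.TensorProduct.congr AlgEquiv.refl (endEquiv σ W).symm).trans (tensorEquiv σ _ _)
  exact e₁.trans ((congr e).trans e₂.symm)

/-- The twist of an Azumaya algebra is Azumaya. -/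
theorem isAzumaya {A : Type u} [Ring A] [Algebra R A] (hA : IsAzumaya R A) :
    IsAzumaya R (Twist σ A) := by
  have : Module.Projective R (Twist σ A) := projective_mod σ A
  have : Module.Finite R (Twist σ A) := finite_mod σ A
  have : FaithfulSMul R (Twist σ A) := faithful_mod σ A
  constructor
  let eop : (Twist σ A)ᵐᵒᵖ ≃ₐ[R] Twist σ Aᵐᵒᵖ :=
    AlgEquiv.ofRingEquiv (f := (of σ A).symm.op.trans (of σ Aᵐᵒᵖ)) (fun r => rfl)
  let e : Twist σ A ⊗[R] (Twist σ A)ᵐᵒᵖ ≃ₐ[R] Module.End R (TwistMod σ A) :=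
    ((Algebra.TensorProduct.congr AlgEquiv.refl eop).trans (tensorEquiv σ A Aᵐᵒᵖ)).trans
      ((congr (AlgEquiv.ofBijective (AlgHom.mulLeftRight R A) IsAzumaya.bij)).trans
        (endEquiv σ A))
  have he : ∀ x, AlgHom.mulLeftRight R (Twist σ A) x = e x := by
    intro x
    induction x with
    | zero => rw [map_zero, map_zero]; rfl
    | add x y hx hy => rw [map_add, map_add, hx, hy]; rfl
    | tmul a b =>
      obtain ⟨a, rfl⟩ := (of σ A).surjective a
      obtain ⟨b, rfl⟩ := MulOpposite.op_surjective b
      obtain ⟨b, rfl⟩ := (of σ A).surjective b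
      have h : e (of σ A a ⊗ₜ[R] MulOpposite.op (of σ A b)) =
          endEquiv σ A (of σ _ (AlgHom.mulLeftRight R A (a ⊗ₜ[R] MulOpposite.op b))) := by
        change endEquiv σ A (congr (AlgEquiv.ofBijective (AlgHom.mulLeftRight R A) IsAzumaya.bij)
          (tensorEquiv σ A Aᵐᵒᵖ (of σ A a ⊗ₜ[R] of σ Aᵐᵒᵖ (MulOpposite.op b)))) = _
        rw [tensorEquiv_tmul]
        rfl
      rw [h]
      apply LinearMap.ext
      intro v
      rw [AlgHom.mulLeftRight_apply]
      obtain ⟨v, rfl⟩ := (of σ A).surjective v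
      change _ = of σ A (AlgHom.mulLeftRight R A (a ⊗ₜ[R] MulOpposite.op b) v)
      rw [AlgHom.mulLeftRight_apply]
      rfl
  exact ⟨fun x y h => e.injective ((he x).symm.trans (h.trans (he y))),
    fun y => (e.surjective y).imp fun x hx => (he x).trans hx⟩

end Twist

/-! ### Automorphisms of affine `k`-schemes and their action on the Brauer group -/

open CategoryTheory AlgebraicGeometry in
/-- The affine `k`-scheme `Spec R`. -/
def specOver (k R : Type u) [CommRing k] [CommRing R] [Algebra k R] : Over (Spec (.of k)) :=
  Over.mk (Spec.map (CommRingCat.ofHom (algebraMap k R)))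

/-- The group `Aut(Spec R)` of automorphisms of `k`-schemes, with `φ * ψ = φ ∘ ψ`. -/
abbrev SchemeAut (k R : Type u) [CommRing k] [CommRing R] [Algebra k R] : Type u :=
  CategoryTheory.Aut (specOver k R)

namespace SchemeAut

open CategoryTheory AlgebraicGeometry

variable {k R : Type u} [CommRing k] [CommRing R] [Algebra k R]

/-- The ring endomorphism of `R` that a `k`-scheme endomorphism of `Spec R` comes from. -/
def ringHom (f : specOver k R ⟶ specOver k R) : CommRingCat.of R ⟶ CommRingCat.of R :=
  Spec.preimage (show Spec (.of R) ⟶ Spec (.of R) from f.left)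

theorem spec_ringHom (f : specOver k R ⟶ specOver k R) : Spec.map (ringHom f) = f.left :=
  Spec.map_preimage _

/-- The algebra endomorphism dual to an endomorphism of the `k`-scheme `Spec R`. -/
def dualHom (f : specOver k R ⟶ specOver k R) : R →ₐ[k] R where
  toRingHom := (ringHom f).hom
  commutes' r := by
    have h : CommRingCat.ofHom (algebraMap k R) ≫ ringHom f
        = CommRingCat.ofHom (algebraMap k R) := by
      apply Spec.map_injective
      rw [Spec.map_comp, spec_ringHom]
      exact Over.w f
    exact congrArg (fun g => g.hom r) h

theorem dualHom_id : dualHom (𝟙 (specOver k R)) = AlgHom.id k R := by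
  have h : ringHom (𝟙 (specOver k R)) = 𝟙 (CommRingCat.of R) := by
    apply Spec.map_injective
    rw [spec_ringHom, Spec.map_id]
    rfl
  ext r
  exact congrArg (fun g => g.hom r) h

theorem dualHom_comp (f g : specOver k R ⟶ specOver k R) :
    dualHom (f ≫ g) = (dualHom f).comp (dualHom g) := by
  have h : ringHom (f ≫ g) = ringHom g ≫ ringHom f := by
    apply Spec.map_injective
    rw [spec_ringHom, Spec.map_comp, spec_ringHom, spec_ringHom]
    rfl
  ext r
  exact congrArg (fun g => g.hom r) h

/-- The algebra automorphism of `R` dual to an automorphism of `Spec R`. -/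
def dual (φ : SchemeAut k R) : R ≃ₐ[k] R :=
  AlgEquiv.ofAlgHom (dualHom (Iso.hom φ)) (dualHom (Iso.inv φ))
    ((dualHom_comp _ _).symm.trans ((congrArg dualHom (Iso.hom_inv_id φ)).trans dualHom_id))
    ((dualHom_comp _ _).symm.trans ((congrArg dualHom (Iso.inv_hom_id φ)).trans dualHom_id))

theorem dual_one_apply (r : R) : dual (1 : SchemeAut k R) r = r :=
  DFunLike.congr_fun dualHom_id r

theorem dual_mul_apply (φ ψ : SchemeAut k R) (r : R) : dual (φ * ψ) r = dual ψ (dual φ r) :=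
  DFunLike.congr_fun (dualHom_comp (Iso.hom ψ) (Iso.hom φ)) r

/-- The endomorphism of the `k`-scheme `Spec R` dual to an algebra endomorphism. -/
def specHom (f : R →ₐ[k] R) : specOver k R ⟶ specOver k R :=
  Over.homMk (Spec.map (CommRingCat.ofHom f.toRingHom)) (by
    change Spec.map _ ≫ Spec.map _ = Spec.map _
    rw [← Spec.map_comp, ← CommRingCat.ofHom_comp]
    congr 2
    ext r
    exact f.commutes r)

theorem specHom_comp (f g : R →ₐ[k] R) : specHom f ≫ specHom g = specHom (f.comp g) := by
  ext1
  change Spec.map _ ≫ Spec.map _ = Spec.map _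
  rw [← Spec.map_comp, ← CommRingCat.ofHom_comp]
  rfl

theorem specHom_id : specHom (AlgHom.id k R) = 𝟙 _ := by
  ext1
  exact Spec.map_id (.of R)

/-- The automorphism `Spec σ` of `Spec R` dual to an algebra automorphism `σ` of `R`. -/
def spec (σ : R ≃ₐ[k] R) : SchemeAut k R where
  hom := specHom σ
  inv := specHom σ.symm
  hom_inv_id := by rw [specHom_comp, AlgEquiv.comp_symm, specHom_id]
  inv_hom_id := by rw [specHom_comp, AlgEquiv.symm_comp, specHom_id]

theorem dual_spec (σ : R ≃ₐ[k] R) : dual (spec σ) = σ := by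
  have h : ringHom (specHom (σ : R →ₐ[k] R)) = CommRingCat.ofHom (σ : R →ₐ[k] R).toRingHom := by
    apply Spec.map_injective
    rw [spec_ringHom]
    rfl
  ext r
  exact congrArg (fun g => g.hom r) h

end SchemeAut

/-- The pushforward `φ_* A` of an `R`-algebra `A` along an automorphism `φ` of `Spec R`: the ring
`A` with the `R`-algebra structure `R → R → A`, the first map being the dual of `φ`. -/
abbrev Pushforward {k R : Type u} [CommRing k] [CommRing R] [Algebra k R] (φ : SchemeAut k R)
    (A : Type u) : Type u :=
  Twist (SchemeAut.dual φ).toRingEquiv A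

namespace Br

variable {k R : Type u} [CommRing k] [CommRing R] [Algebra k R]

/-- The pushforward of an Azumaya algebra. -/
def _root_.AzumayaAlgebra.pushforward (φ : SchemeAut k R) (A : AzumayaAlgebra R) :
    AzumayaAlgebra R :=
  @AzumayaAlgebra.mk R _ (Pushforward φ A) _ _ (Twist.isAzumaya _ A.isAzumaya)

/-- `Aut(Spec R)` acts on `Br(Spec R)` by pushforward, `φ • [A] = [φ_* A]`. -/
instance : MulAction (SchemeAut k R) (Br R) where
  smul φ := Quotient.map (AzumayaAlgebra.pushforward φ) (fun A B (h : BrauerEquiv R A B) =>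
    (Twist.brauerEquiv (SchemeAut.dual φ).toRingEquiv h :
      BrauerEquiv R (Pushforward φ A) (Pushforward φ B)))
  one_smul x := by
    induction x using ind with
    | h A hA =>
    have e : Pushforward (1 : SchemeAut k R) A ≃ₐ[R] A :=
      Twist.algEquivOfRingEquiv (RingEquiv.refl A)
        (fun r => congrArg (algebraMap R A) (SchemeAut.dual_one_apply (k := k) r))
    exact Quotient.sound (BrauerEquiv.of_algEquiv e)
  mul_smul φ ψ x := by
    induction x using ind with
    | h A hA =>
    have e : Pushforward (φ * ψ) A ≃ₐ[R] Pushforward φ (Pushforward ψ A) :=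
      Twist.algEquivOfRingEquiv
        ((Twist.of (SchemeAut.dual ψ).toRingEquiv A).trans
          (Twist.of (SchemeAut.dual φ).toRingEquiv (Pushforward ψ A)))
        (fun r => congrArg (algebraMap R A) (SchemeAut.dual_mul_apply φ ψ r))
    exact Quotient.sound (BrauerEquiv.of_algEquiv e)

theorem smul_mk (φ : SchemeAut k R) (A : Type u) [Ring A] [Algebra R A] (hA : IsAzumaya R A) :
    φ • mk R A hA = mk R (Pushforward φ A) (Twist.isAzumaya _ hA) :=
  rfl

end Br

/-! ### Weyl algebras -/

/-- The structure constants of the Weyl algebra: with the generators `x₁, …, xₙ` indexed by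
`Sum.inl` and `xₙ₊₁, …, x₂ₙ` by `Sum.inr`, the value at `(i, j)` is `δ_{i,j+n} - δ_{i+n,j}`. -/
def weylForm (k : Type u) [Field k] (n : ℕ) : Fin n ⊕ Fin n → Fin n ⊕ Fin n → k
  | .inr i, .inl j => if i = j then 1 else 0
  | .inl i, .inr j => if i = j then -1 else 0
  | .inl _, .inl _ => 0
  | .inr _, .inr _ => 0

/-- The defining relations `[xᵢ, xⱼ] = δ_{i,j+n} - δ_{i+n,j}` of the Weyl algebra. -/
inductive WeylRel (k : Type u) [Field k] (n : ℕ) :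
    FreeAlgebra k (Fin n ⊕ Fin n) → FreeAlgebra k (Fin n ⊕ Fin n) → Prop
  | commutator (i j : Fin n ⊕ Fin n) : WeylRel k n
      (FreeAlgebra.ι k i * FreeAlgebra.ι k j - FreeAlgebra.ι k j * FreeAlgebra.ι k i)
      (algebraMap k _ (weylForm k n i j))

/-- The Weyl algebra `A_n(k)`. -/
def WeylAlgebra (k : Type u) [Field k] (n : ℕ) : Type u := RingQuot (WeylRel k n)

namespace WeylAlgebra

variable (k : Type u) [Field k] (n : ℕ)

instance : Ring (WeylAlgebra k n) := inferInstanceAs (Ring (RingQuot (WeylRel k n)))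

instance : Algebra k (WeylAlgebra k n) := inferInstanceAs (Algebra k (RingQuot (WeylRel k n)))

/-- The quotient map from the free algebra. -/
def mk : FreeAlgebra k (Fin n ⊕ Fin n) →ₐ[k] WeylAlgebra k n :=
  RingQuot.mkAlgHom k (WeylRel k n)

/-- The generators `xᵢ` of the Weyl algebra. -/
def x (i : Fin n ⊕ Fin n) : WeylAlgebra k n := mk k n (FreeAlgebra.ι k i)

theorem commutator (i j : Fin n ⊕ Fin n) :
    x k n i * x k n j - x k n j * x k n i = algebraMap k _ (weylForm k n i j) := by
  have h : mk k n _ = mk k n _ :=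
    RingQuot.mkAlgHom_rel k (WeylRel.commutator (k := k) (n := n) i j)
  rwa [map_sub, map_mul, map_mul, AlgHom.commutes] at h

theorem mem_center {a : WeylAlgebra k n} (h : ∀ i, x k n i * a = a * x k n i) :
    a ∈ Subalgebra.center k (WeylAlgebra k n) := by
  rw [Subalgebra.mem_center_iff]
  intro b
  obtain ⟨b, rfl⟩ : ∃ b', mk k n b' = b := RingQuot.mkAlgHom_surjective k (WeylRel k n) b
  induction b using FreeAlgebra.induction with
  | grade0 r =>
    rw [AlgHom.commutes]
    exact Algebra.commutes r a
  | grade1 i => exact h i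
  | mul b c hb hc => rw [map_mul, mul_assoc, hc, ← mul_assoc, hb, mul_assoc]
  | add b c hb hc => rw [map_add, add_mul, mul_add, hb, hc]

theorem commutator_pow (i j : Fin n ⊕ Fin n) (m : ℕ) :
    x k n i * x k n j ^ (m + 1) - x k n j ^ (m + 1) * x k n i
      = algebraMap k _ ((m + 1) * weylForm k n i j) * x k n j ^ m := by
  induction m with
  | zero => simpa using commutator k n i j
  | succ m ih =>
    have h1 : x k n i * x k n j ^ (m + 1 + 1) - x k n j ^ (m + 1 + 1) * x k n i =
        (x k n i * x k n j ^ (m + 1) - x k n j ^ (m + 1) * x k n i) * x k n j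
        + x k n j ^ (m + 1) * (x k n i * x k n j - x k n j * x k n i) := by
      rw [pow_succ _ (m + 1)]; noncomm_ring
    rw [h1, ih, commutator, mul_assoc, ← pow_succ, ← Algebra.commutes, ← add_mul, ← map_add]
    congr 2
    push_cast; ring

/-- In characteristic `p` the powers `xᵢᵖ` are central. -/
theorem x_pow_mem_center (i : Fin n ⊕ Fin n) :
    x k n i ^ ringChar k ∈ Subalgebra.center k (WeylAlgebra k n) := by
  apply mem_center
  intro j
  rcases h : ringChar k with _ | m
  · simp
  · have h1 := commutator_pow k n j i m
    have h2 : ((m : k) + 1) = 0 := by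
      have := ringChar.Nat.cast_ringChar (R := k)
      rw [h] at this
      exact_mod_cast this
    rw [h2, zero_mul, map_zero, zero_mul, sub_eq_zero] at h1
    exact h1

end WeylAlgebra

/-- `Z_n(k)`, the polynomial ring over `k` in `2n` variables `zᵢ`; it acts on the Weyl algebra
through `zᵢ ↦ xᵢᵖ`, where `p` is the characteristic of `k`, below. -/
abbrev WeylCenter (k : Type u) [Field k] (n : ℕ) : Type u := MvPolynomial (Fin n ⊕ Fin n) k

namespace WeylCenter

variable (k : Type u) [Field k] (n : ℕ)

/-- The homomorphism `zᵢ ↦ xᵢᵖ` from `Z_n(k)` to the center of the Weyl algebra. -/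
def toCenter : WeylCenter k n →ₐ[k] Subalgebra.center k (WeylAlgebra k n) :=
  MvPolynomial.aeval fun i => ⟨WeylAlgebra.x k n i ^ ringChar k, WeylAlgebra.x_pow_mem_center k n i⟩

/-- The `Z_n(k)`-algebra structure of the Weyl algebra given by `zᵢ ↦ xᵢᵖ`. -/
instance : Algebra (WeylCenter k n) (WeylAlgebra k n) :=
  RingHom.toAlgebra' ((Subalgebra.center k (WeylAlgebra k n)).val.toRingHom.comp
    (toCenter k n).toRingHom) fun r a =>
      ((Subalgebra.mem_center_iff (R := k)).1 (toCenter k n r).2 a).symm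

theorem algebraMap_X (i : Fin n ⊕ Fin n) :
    algebraMap (WeylCenter k n) (WeylAlgebra k n) (MvPolynomial.X i)
      = WeylAlgebra.x k n i ^ ringChar k := by
  change ((toCenter k n (MvPolynomial.X i) : Subalgebra.center k (WeylAlgebra k n)) :
    WeylAlgebra k n) = _
  rw [toCenter, MvPolynomial.aeval_X]

variable {k}

/-- The scaling factors: `1` on the first `n` coordinates, `c⁻¹` on the last `n`. -/
def scale (c : kˣ) : Fin n ⊕ Fin n → k
  | .inl _ => 1
  | .inr _ => ((c⁻¹ : kˣ) : k)

theorem scale_mul_scale_inv (c : kˣ) (i : Fin n ⊕ Fin n) : scale n c i * scale n c⁻¹ i = 1 := by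
  cases i <;> simp [scale]

/-- The endomorphism of `Z_n(k)` scaling the last `n` variables by `c⁻¹`. -/
def omegaBarHom (c : kˣ) : WeylCenter k n →ₐ[k] WeylCenter k n :=
  MvPolynomial.aeval fun i => MvPolynomial.C (scale n c i) * MvPolynomial.X i

theorem omegaBarHom_comp_inv (c : kˣ) :
    (omegaBarHom n c).comp (omegaBarHom n c⁻¹) = AlgHom.id k _ := by
  apply MvPolynomial.algHom_ext
  intro i
  simp only [omegaBarHom, AlgHom.comp_apply, MvPolynomial.aeval_X, map_mul, AlgHom.id_apply,
    MvPolynomial.algHom_C, MvPolynomial.algebraMap_eq]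
  rw [← mul_assoc, ← map_mul, mul_comm (scale n c⁻¹ i), scale_mul_scale_inv, map_one, one_mul]

/-- The automorphism of `Z_n(k)` scaling the last `n` variables by `c⁻¹`. -/
def omegaBar (c : kˣ) : WeylCenter k n ≃ₐ[k] WeylCenter k n :=
  AlgEquiv.ofAlgHom (omegaBarHom n c) (omegaBarHom n c⁻¹) (omegaBarHom_comp_inv n c)
    (by simpa using omegaBarHom_comp_inv n c⁻¹)

/-- The automorphism `ω(c)` of `𝔸²ⁿ = Spec Z_n(k)` dual to `omegaBar n c`. -/
def omega (c : kˣ) : SchemeAut k (WeylCenter k n) :=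
  SchemeAut.spec (omegaBar n c)

end WeylCenter

end

/-!
For a commutative ring `R` of odd prime characteristic `p` and `a, b ∈ R`, let `S(a, b)` be the algebra
generated by `u, v` with `v u = u v + 1`, `uᵖ = a`, `vᵖ = b`; for families `a, b` take one such pair
for every index, the pairs commuting with each other (`SymbolAlgebra`). Because the rescaling `ω(c)`
multiplies the last `n` coordinates, the pushforward `ω(c)_* A_n(k)` is the symbol algebra over
`Z_n(k)` with parameters `zᵢ` and `c zₙ₊ᵢ`
(`WeylAlgebra.nonempty_pushforward_algEquiv`), and this family makes sense for `c = 0` too. So the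
theorem says that `b ↦ [S(a, b)]` is additive, and that `[S(z, c z')]` is nontrivial for `c ≠ 0`.

*Additivity.* The linear symplectic change of variables
`(u, v, u', v') ↦ (u, v + v', u' - u, v')` preserves the Weyl relations, and in characteristic `p`
the `p`-th power map is additive on commuting elements. This yields
`S(a, b) ⊗ S(a, b') ≅ S(a, b + b') ⊗ S(0, b')` (`SymbolAlgebra.tensorEquiv`). The algebra `S(a, 0)`
acts on `R[T] / (Tᵖ - a)` by `u = T`, `v = d/dT`. The action is onto all endomorphisms because of the
identity `∑ₗ Tᵖ⁻¹⁻ˡ Dᵖ⁻¹ Tˡ = -1` (`sum_pow_mul_pow_mul_pow`), and `S(a, 0)` is spanned by `p²`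
monomials, so it is an endomorphism algebra (`SymbolAlgebra.zeroEquiv`). After exchanging `u` and `v`
the same holds for `S(0, b')`.

*The Azumaya property.* By additivity `S(a, b) ⊗ S(a, -b)` is an endomorphism algebra of a free
module of rank `p²`; comparing ranks, the `p²` monomials are a basis of `S(a, b)`, and the center is
`R`. The identity above, applied to the inner derivations of `u` and `v`, then shows that left and
right multiplications generate `End_R S(a, b)` (`mulLeftRight_surjective_of_weyl`).

*Nontriviality.* For `c ≠ 0` the algebra `S(z, c z')` is isomorphic, as a ring, to the Weyl algebra.
The Weyl algebra acts on polynomials by `Xᵢ` and `Xₙ₊ᵢ + ∂ᵢ`. This is its left regular representation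
written in normally ordered monomials, it is faithful because the algebra is Azumaya, and the
operators have multiplicative leading symbols, so the Weyl algebra is a domain
(`WeylAlgebra.noZeroDivisors`). On the other hand, a reduced torsion-free algebra with trivial Brauer
class over a domain is commutative (`BrauerEquiv.mul_comm_of_isReduced`).

For the second part, `ω(c)` and `ω(d)` are in the same coset of the stabilizer if and only if they
map `[A_n(k)]` to the same class.
-/

/-! ### Symbol algebras -/

/-- Elements `uᵢ, vᵢ` of an `R`-algebra satisfying the Weyl relations `[vᵢ, uⱼ] = δᵢⱼ`,
`[uᵢ, uⱼ] = [vᵢ, vⱼ] = 0` together with `uᵢᵖ = aᵢ` and `vᵢᵖ = bᵢ`. -/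
structure IsWeylSystem {R A : Type*} [CommRing R] [Ring A] [Algebra R A] {ι : Type*} (p : ℕ)
    (a b : ι → R) (u v : ι → A) : Prop where
  uu : ∀ i j, u i * u j = u j * u i
  vv : ∀ i j, v i * v j = v j * v i
  vu_self : ∀ i, v i * u i = u i * v i + 1
  vu_ne : ∀ i j, i ≠ j → v i * u j = u j * v i
  u_pow : ∀ i, u i ^ p = algebraMap R A (a i)
  v_pow : ∀ i, v i ^ p = algebraMap R A (b i)

/-- The defining relations of `SymbolAlgebra p a b`; the generators `uᵢ` are indexed by `Sum.inl`
and the `vᵢ` by `Sum.inr`. -/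
inductive SymbolAlgebra.Rel {R : Type*} [CommRing R] {ι : Type*} (p : ℕ) (a b : ι → R) :
    FreeAlgebra R (ι ⊕ ι) → FreeAlgebra R (ι ⊕ ι) → Prop
  | uu (i j : ι) : Rel p a b (FreeAlgebra.ι R (.inl i) * FreeAlgebra.ι R (.inl j))
      (FreeAlgebra.ι R (.inl j) * FreeAlgebra.ι R (.inl i))
  | vv (i j : ι) : Rel p a b (FreeAlgebra.ι R (.inr i) * FreeAlgebra.ι R (.inr j))
      (FreeAlgebra.ι R (.inr j) * FreeAlgebra.ι R (.inr i))
  | vu_self (i : ι) : Rel p a b (FreeAlgebra.ι R (.inr i) * FreeAlgebra.ι R (.inl i))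
      (FreeAlgebra.ι R (.inl i) * FreeAlgebra.ι R (.inr i) + 1)
  | vu_ne (i j : ι) (h : i ≠ j) : Rel p a b (FreeAlgebra.ι R (.inr i) * FreeAlgebra.ι R (.inl j))
      (FreeAlgebra.ι R (.inl j) * FreeAlgebra.ι R (.inr i))
  | u_pow (i : ι) : Rel p a b (FreeAlgebra.ι R (.inl i) ^ p) (algebraMap R _ (a i))
  | v_pow (i : ι) : Rel p a b (FreeAlgebra.ι R (.inr i) ^ p) (algebraMap R _ (b i))

/-- The universal `R`-algebra generated by elements `uᵢ, vᵢ` satisfying the Weyl relations and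
`uᵢᵖ = aᵢ`, `vᵢᵖ = bᵢ`. In characteristic `p` it is the tensor product of the differential symbol
algebras `[aᵢ bᵢ, aᵢ)` (where these are defined). -/
def SymbolAlgebra {R : Type*} [CommRing R] {ι : Type*} (p : ℕ) (a b : ι → R) :=
  RingQuot (SymbolAlgebra.Rel p a b)

namespace SymbolAlgebra

variable {R : Type*} [CommRing R] {ι κ : Type*} (p : ℕ) (a b : ι → R)

noncomputable instance : Ring (SymbolAlgebra p a b) :=
  inferInstanceAs (Ring (RingQuot (SymbolAlgebra.Rel p a b)))

noncomputable instance : Algebra R (SymbolAlgebra p a b) :=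
  inferInstanceAs (Algebra R (RingQuot (SymbolAlgebra.Rel p a b)))

/-- The quotient map from the free algebra. -/
noncomputable def mk : FreeAlgebra R (ι ⊕ ι) →ₐ[R] SymbolAlgebra p a b :=
  RingQuot.mkAlgHom R (SymbolAlgebra.Rel p a b)

/-- The generators `uᵢ`. -/
noncomputable def u (i : ι) : SymbolAlgebra p a b := mk p a b (FreeAlgebra.ι R (.inl i))

/-- The generators `vᵢ`. -/
noncomputable def v (i : ι) : SymbolAlgebra p a b := mk p a b (FreeAlgebra.ι R (.inr i))

theorem mk_rel {x y : FreeAlgebra R (ι ⊕ ι)} (h : Rel p a b x y) : mk p a b x = mk p a b y :=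
  RingQuot.mkAlgHom_rel R h

theorem mk_surjective : Function.Surjective (mk p a b) :=
  RingQuot.mkAlgHom_surjective R (SymbolAlgebra.Rel p a b)

theorem isWeylSystem : IsWeylSystem p a b (u p a b) (v p a b) where
  uu i j := by simpa [u, v] using mk_rel p a b (.uu i j)
  vv i j := by simpa [u, v] using mk_rel p a b (.vv i j)
  vu_self i := by simpa [u, v] using mk_rel p a b (.vu_self i)
  vu_ne i j h := by simpa [u, v] using mk_rel p a b (.vu_ne i j h)
  u_pow i := by simpa [u, v] using mk_rel p a b (.u_pow i)
  v_pow i := by simpa [u, v] using mk_rel p a b (.v_pow i)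

variable {p a b}

/-- The universal property of the symbol algebra. -/
noncomputable def lift {A : Type*} [Ring A] [Algebra R A] {u v : ι → A}
    (h : IsWeylSystem p a b u v) : SymbolAlgebra p a b →ₐ[R] A :=
  RingQuot.liftAlgHom R ⟨FreeAlgebra.lift R (Sum.elim u v), by
    intro x y hxy
    induction hxy with
    | uu i j => simpa using h.uu i j
    | vv i j => simpa using h.vv i j
    | vu_self i => simpa using h.vu_self i
    | vu_ne i j hij => simpa using h.vu_ne i j hij
    | u_pow i => simpa using h.u_pow i
    | v_pow i => simpa using h.v_pow i⟩

section

variable {A : Type*} [Ring A] [Algebra R A] {u' v' : ι → A} (h : IsWeylSystem p a b u' v')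

@[simp] theorem lift_u (i : ι) : lift h (u p a b i) = u' i := by
  simp only [lift, u, mk]
  exact (RingQuot.liftAlgHom_mkAlgHom_apply R _ _ _).trans (by simp)

@[simp] theorem lift_v (i : ι) : lift h (v p a b i) = v' i := by
  simp only [lift, v, mk]
  exact (RingQuot.liftAlgHom_mkAlgHom_apply R _ _ _).trans (by simp)

end

/-- Induction principle: a property that holds for scalars and generators and is stable under
sums and products holds everywhere. -/
theorem induction {P : SymbolAlgebra p a b → Prop} (hr : ∀ r, P (algebraMap R _ r))
    (hu : ∀ i, P (u p a b i)) (hv : ∀ i, P (v p a b i)) (hmul : ∀ x y, P x → P y → P (x * y))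
    (hadd : ∀ x y, P x → P y → P (x + y)) (x : SymbolAlgebra p a b) : P x := by
  obtain ⟨x, rfl⟩ := mk_surjective p a b x
  induction x using FreeAlgebra.induction with
  | grade0 r => rw [AlgHom.commutes]; exact hr r
  | grade1 i => rcases i with i | i; exacts [hu i, hv i]
  | mul x y hx hy => rw [map_mul]; exact hmul _ _ hx hy
  | add x y hx hy => rw [map_add]; exact hadd _ _ hx hy

theorem algHom_ext {A : Type*} [Ring A] [Algebra R A] {f g : SymbolAlgebra p a b →ₐ[R] A}
    (hu : ∀ i, f (u p a b i) = g (u p a b i)) (hv : ∀ i, f (v p a b i) = g (v p a b i)) :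
    f = g := by
  ext x
  induction x using induction with
  | hr r => simp
  | hu i => exact hu i
  | hv i => exact hv i
  | hmul x y hx hy => simp [hx, hy]
  | hadd x y hx hy => simp [hx, hy]

theorem commute_of_commute {A : Type*} [Ring A] [Algebra R A] (f : SymbolAlgebra p a b →ₐ[R] A)
    {t : A} (hu : ∀ i, Commute (f (u p a b i)) t) (hv : ∀ i, Commute (f (v p a b i)) t)
    (x : SymbolAlgebra p a b) : Commute (f x) t := by
  induction x using induction with
  | hr r => rw [AlgHom.commutes]; exact Algebra.commute_algebraMap_left r t
  | hu i => exact hu i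
  | hv i => exact hv i
  | hmul x y hx hy => rw [map_mul]; exact hx.mul_left hy
  | hadd x y hx hy => rw [map_add]; exact hx.add_left hy

end SymbolAlgebra

namespace IsWeylSystem

variable {R A B : Type*} [CommRing R] [Ring A] [Algebra R A] [Ring B] [Algebra R B] {ι κ : Type*}
  {p : ℕ} {a b : ι → R} {u v : ι → A}

theorem map (h : IsWeylSystem p a b u v) (f : A →ₐ[R] B) :
    IsWeylSystem p a b (fun i => f (u i)) (fun i => f (v i)) where
  uu i j := by simpa using congrArg f (h.uu i j)
  vv i j := by simpa using congrArg f (h.vv i j)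
  vu_self i := by simpa using congrArg f (h.vu_self i)
  vu_ne i j hij := by simpa using congrArg f (h.vu_ne i j hij)
  u_pow i := by simpa using congrArg f (h.u_pow i)
  v_pow i := by simpa using congrArg f (h.v_pow i)

theorem comp (h : IsWeylSystem p a b u v) {e : κ → ι} (he : Function.Injective e) :
    IsWeylSystem p (a ∘ e) (b ∘ e) (u ∘ e) (v ∘ e) where
  uu _ _ := h.uu _ _
  vv _ _ := h.vv _ _
  vu_self _ := h.vu_self _
  vu_ne _ _ hij := h.vu_ne _ _ (he.ne hij)
  u_pow _ := h.u_pow _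
  v_pow _ := h.v_pow _

/-- Two commuting Weyl systems form a Weyl system. -/
theorem sumElim {c d : κ → R} {s t : κ → A} (h : IsWeylSystem p a b u v)
    (h' : IsWeylSystem p c d s t) (hus : ∀ i j, u i * s j = s j * u i)
    (hut : ∀ i j, u i * t j = t j * u i) (hvs : ∀ i j, v i * s j = s j * v i)
    (hvt : ∀ i j, v i * t j = t j * v i) :
    IsWeylSystem p (Sum.elim a c) (Sum.elim b d) (Sum.elim u s) (Sum.elim v t) where
  uu := by rintro (i | i) (j | j); exacts [h.uu i j, hus i j, (hus j i).symm, h'.uu i j]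
  vv := by rintro (i | i) (j | j); exacts [h.vv i j, hvt i j, (hvt j i).symm, h'.vv i j]
  vu_self := by rintro (i | i); exacts [h.vu_self i, h'.vu_self i]
  vu_ne := by
    rintro (i | i) (j | j) hij
    exacts [h.vu_ne i j (fun e => hij (e ▸ rfl)), hvs i j, (hut j i).symm,
      h'.vu_ne i j (fun e => hij (e ▸ rfl))]
  u_pow := by rintro (i | i); exacts [h.u_pow i, h'.u_pow i]
  v_pow := by rintro (i | i); exacts [h.v_pow i, h'.v_pow i]

end IsWeylSystem

namespace SymbolAlgebra

variable {R : Type*} [CommRing R] {ι κ : Type*} {p : ℕ}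

open Algebra.TensorProduct in
/-- The symbol algebra of a disjoint union is a tensor product of symbol algebras. -/
noncomputable def sumEquiv (a b : ι → R) (c d : κ → R) :
    SymbolAlgebra p (Sum.elim a c) (Sum.elim b d) ≃ₐ[R]
      SymbolAlgebra p a b ⊗[R] SymbolAlgebra p c d := by
  have h := isWeylSystem p (Sum.elim a c) (Sum.elim b d)
  have hl : IsWeylSystem p a b (fun i => u p (Sum.elim a c) (Sum.elim b d) (.inl i))
      (fun i => v p (Sum.elim a c) (Sum.elim b d) (.inl i)) := h.comp Sum.inl_injective
  have hr : IsWeylSystem p c d (fun i => u p (Sum.elim a c) (Sum.elim b d) (.inr i))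
      (fun i => v p (Sum.elim a c) (Sum.elim b d) (.inr i)) := h.comp Sum.inr_injective
  have hf := ((isWeylSystem p a b).map
      (includeLeft : _ →ₐ[R] SymbolAlgebra p a b ⊗[R] SymbolAlgebra p c d)).sumElim
      ((isWeylSystem p c d).map (includeRight : _ →ₐ[R] SymbolAlgebra p a b ⊗[R] _))
      (by simp) (by simp) (by simp) (by simp)
  have hc : ∀ x y, Commute (lift hl x) (lift hr y) := fun x y =>
    commute_of_commute (lift hl)
      (fun i => (commute_of_commute (lift hr)
        (fun j => by rw [lift_u, lift_u]; exact h.uu (.inr j) (.inl i))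
        (fun j => by rw [lift_u, lift_v]; exact h.vu_ne (.inr j) (.inl i) (by simp)) y).symm)
      (fun i => (commute_of_commute (lift hr)
        (fun j => by rw [lift_u, lift_v]; exact (h.vu_ne (.inl i) (.inr j) (by simp)).symm)
        (fun j => by rw [lift_v, lift_v]; exact h.vv (.inr j) (.inl i)) y).symm) x
  refine AlgEquiv.ofAlgHom (lift hf) (Algebra.TensorProduct.lift (lift hl) (lift hr) hc) ?_ ?_
  · exact Algebra.TensorProduct.ext
      (algHom_ext (by simp) (by simp)) (algHom_ext (by simp) (by simp))
  · refine algHom_ext ?_ ?_ <;> rintro (i | i) <;> simp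

/-- The symbol algebra depends only on the index type up to bijection. -/
noncomputable def reindex (e : κ ≃ ι) (a b : ι → R) :
    SymbolAlgebra p (a ∘ e) (b ∘ e) ≃ₐ[R] SymbolAlgebra p a b := by
  have h := (isWeylSystem p (a ∘ e) (b ∘ e)).comp e.symm.injective
  rw [Function.comp_assoc, Function.comp_assoc, Equiv.self_comp_symm, Function.comp_id,
    Function.comp_id] at h
  exact AlgEquiv.ofAlgHom (lift ((isWeylSystem p a b).comp e.injective)) (lift h)
    (algHom_ext (by simp) (by simp)) (algHom_ext (by simp) (by simp))

/-- Exchanging the roles of the two halves of the generators. -/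
noncomputable def swap (hp : Odd p) (a b : ι → R) :
    SymbolAlgebra p a b ≃ₐ[R] SymbolAlgebra p b (-a) := by
  have h := isWeylSystem p b (-a)
  have h' := isWeylSystem p a b
  refine AlgEquiv.ofAlgHom
    (lift (u := fun i => - v p b (-a) i) (v := fun i => u p b (-a) i)
      ⟨fun i j => by simpa using h.vv i j, fun i j => h.uu i j, fun i => by simp [h.vu_self i],
        fun i j hij => by simpa using (h.vu_ne j i hij.symm).symm,
        fun i => by rw [hp.neg_pow, h.v_pow i]; simp, fun i => h.u_pow i⟩)
    (lift (u := fun i => v p a b i) (v := fun i => - u p a b i)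
      ⟨fun i j => h'.vv i j, fun i j => by simpa using h'.uu i j, fun i => by simp [h'.vu_self i],
        fun i j hij => by simpa using (h'.vu_ne j i hij.symm).symm,
        fun i => h'.v_pow i, fun i => by rw [hp.neg_pow, h'.u_pow i]; simp⟩)
    (algHom_ext (by simp) (by simp)) (algHom_ext (by simp) (by simp))

end SymbolAlgebra

namespace IsWeylSystem

variable {R A : Type*} [CommRing R] [Ring A] [Algebra R A] {ι : Type*} {p : ℕ} {a a' b b' : ι → R}
  {s t : ι ⊕ ι → A}

theorem _root_.add_pow_of_commute_of_algebra [CharP R p] [hp : Fact p.Prime] {x y : A}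
    (h : x * y = y * x) : (x + y) ^ p = x ^ p + y ^ p := by
  obtain ⟨r, hr⟩ := Commute.exists_add_pow_prime_eq hp.1 (show Commute x y from h)
  have hp0 : (p : A) = 0 := by
    rw [← map_natCast (algebraMap R A), CharP.cast_eq_zero, map_zero]
  rw [hr, hp0, zero_mul, zero_mul, zero_mul, add_zero]

theorem _root_.sub_pow_of_commute_of_algebra [CharP R p] [Fact p.Prime] {x y : A}
    (h : x * y = y * x) : (x - y) ^ p = x ^ p - y ^ p := by
  have := add_pow_of_commute_of_algebra (R := R) (A := A) (p := p) (x := x - y) (y := y)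
    (by rw [sub_mul, mul_sub, h])
  rw [sub_add_cancel] at this
  rw [this, add_sub_cancel_right]

/-- The linear symplectic change of variables `(u, v, u', v') ↦ (u, v + v', u' - u, v')` preserves
the Weyl relations; it turns a pair of symbols with values `(a, b)`, `(a', b')` into one with
values `(a, b + b')`, `(a' - a, b')`. -/
theorem shear [CharP R p] [Fact p.Prime]
    (h : IsWeylSystem p (Sum.elim a a') (Sum.elim b b') s t) :
    IsWeylSystem p (Sum.elim a (a' - a)) (Sum.elim (b + b') b')
      (Sum.elim (fun i => s (.inl i)) (fun i => s (.inr i) - s (.inl i)))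
      (Sum.elim (fun i => t (.inl i) + t (.inr i)) (fun i => t (.inr i))) where
  uu := by
    have := h.uu
    rintro (i | i) (j | j) <;> simp [mul_sub, sub_mul, this _ (.inl j), this _ (.inr j)]
    all_goals abel
  vv := by
    have := h.vv
    rintro (i | i) (j | j) <;> simp [mul_add, add_mul, this _ (.inl j), this _ (.inr j)]
    all_goals abel
  vu_self := by
    rintro (i | i)
    · simp only [Sum.elim_inl, add_mul, mul_add, h.vu_self, h.vu_ne (.inr i) (.inl i) (by simp)]
      abel
    · simp only [Sum.elim_inr, sub_mul, mul_sub, h.vu_self, h.vu_ne (.inr i) (.inl i) (by simp)]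
      abel
  vu_ne := by
    have key : ∀ i j, i ≠ j → ∀ x ∈ [Sum.inl i, Sum.inr i], ∀ y ∈ [Sum.inl j, Sum.inr j],
        t x * s y = s y * t x := by
      intro i j hij x hx y hy
      refine h.vu_ne x y ?_
      rintro rfl
      simp at hx hy
      grind
    rintro (i | i) (j | j) hij
    · have hij' : i ≠ j := fun e => hij (e ▸ rfl)
      simp [add_mul, mul_add, key i j hij']
    · by_cases e : i = j
      · subst e
        -- the two contributions of `+1` cancel: `[v + v', u' - u] = 1 - 1`
        simp only [Sum.elim_inl, Sum.elim_inr, add_mul, mul_add, sub_mul, mul_sub, h.vu_self,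
          h.vu_ne (.inl i) (.inr i) (by simp), h.vu_ne (.inr i) (.inl i) (by simp)]
        abel
      · simp only [Sum.elim_inl, Sum.elim_inr, add_mul, mul_add, sub_mul, mul_sub, key i j e,
          List.mem_cons, true_or, or_true]
        abel
    · simp only [Sum.elim_inl, Sum.elim_inr]
      exact h.vu_ne _ _ (by simp)
    · have hij' : i ≠ j := fun e => hij (e ▸ rfl)
      simp [sub_mul, mul_sub, key i j hij']
  u_pow := by
    rintro (i | i)
    · simpa using h.u_pow (.inl i)
    · simp only [Sum.elim_inr]
      rw [sub_pow_of_commute_of_algebra (R := R) (h.uu _ _), h.u_pow, h.u_pow]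
      simp
  v_pow := by
    rintro (i | i)
    · simp only [Sum.elim_inl]
      rw [add_pow_of_commute_of_algebra (R := R) (h.vv _ _), h.v_pow, h.v_pow]
      simp
    · simpa using h.v_pow (.inr i)

/-- The inverse of the change of variables `IsWeylSystem.shear`. -/
theorem unshear [CharP R p] [Fact p.Prime]
    (h : IsWeylSystem p (Sum.elim a a') (Sum.elim (b + b') b') s t) :
    IsWeylSystem p (Sum.elim a (a' + a)) (Sum.elim b b')
      (Sum.elim (fun i => s (.inl i)) (fun i => s (.inr i) + s (.inl i)))
      (Sum.elim (fun i => t (.inl i) - t (.inr i)) (fun i => t (.inr i))) where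
  uu := by
    have := h.uu
    rintro (i | i) (j | j) <;> simp [mul_add, add_mul, this _ (.inl j), this _ (.inr j)]
    all_goals abel
  vv := by
    have := h.vv
    rintro (i | i) (j | j) <;> simp [mul_sub, sub_mul, this _ (.inl j), this _ (.inr j)]
    all_goals abel
  vu_self := by
    rintro (i | i)
    · simp only [Sum.elim_inl, sub_mul, mul_sub, h.vu_self, h.vu_ne (.inr i) (.inl i) (by simp)]
      abel
    · simp only [Sum.elim_inr, add_mul, mul_add, h.vu_self, h.vu_ne (.inr i) (.inl i) (by simp)]
      abel
  vu_ne := by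
    have key : ∀ i j, i ≠ j → ∀ x ∈ [Sum.inl i, Sum.inr i], ∀ y ∈ [Sum.inl j, Sum.inr j],
        t x * s y = s y * t x := by
      intro i j hij x hx y hy
      refine h.vu_ne x y ?_
      rintro rfl
      simp at hx hy
      grind
    rintro (i | i) (j | j) hij
    · have hij' : i ≠ j := fun e => hij (e ▸ rfl)
      simp [sub_mul, mul_sub, key i j hij']
    · by_cases e : i = j
      · subst e
        simp only [Sum.elim_inl, Sum.elim_inr, add_mul, mul_add, sub_mul, mul_sub, h.vu_self,
          h.vu_ne (.inl i) (.inr i) (by simp), h.vu_ne (.inr i) (.inl i) (by simp)]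
        abel
      · simp only [Sum.elim_inl, Sum.elim_inr, add_mul, mul_add, sub_mul, mul_sub, key i j e,
          List.mem_cons, true_or, or_true]
        abel
    · simp only [Sum.elim_inl, Sum.elim_inr]
      exact h.vu_ne _ _ (by simp)
    · have hij' : i ≠ j := fun e => hij (e ▸ rfl)
      simp [add_mul, mul_add, key i j hij']
  u_pow := by
    rintro (i | i)
    · simpa using h.u_pow (.inl i)
    · simp only [Sum.elim_inr]
      rw [add_pow_of_commute_of_algebra (R := R) (h.uu _ _), h.u_pow, h.u_pow]
      simp
  v_pow := by
    rintro (i | i)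
    · simp only [Sum.elim_inl]
      rw [sub_pow_of_commute_of_algebra (R := R) (h.vv _ _), h.v_pow, h.v_pow]
      simp
    · simpa using h.v_pow (.inr i)

end IsWeylSystem

namespace SymbolAlgebra

variable {R : Type*} [CommRing R] {ι κ : Type*} {p : ℕ}

/-- The addition law for symbols. -/
noncomputable def tensorEquiv [CharP R p] [Fact p.Prime] (a b b' : ι → R) :
    SymbolAlgebra p a b ⊗[R] SymbolAlgebra p a b' ≃ₐ[R]
      SymbolAlgebra p a (b + b') ⊗[R] SymbolAlgebra p (0 : ι → R) b' := by
  have h := (isWeylSystem p (Sum.elim a a) (Sum.elim b b')).shear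
  have h' := (isWeylSystem p (Sum.elim a 0) (Sum.elim (b + b') b')).unshear
  rw [sub_self] at h
  rw [zero_add] at h'
  refine (sumEquiv a b a b').symm.trans (.trans ?_ (sumEquiv a (b + b') 0 b'))
  refine AlgEquiv.ofAlgHom (lift h') (lift h) (algHom_ext ?_ ?_) (algHom_ext ?_ ?_) <;>
    rintro (i | i) <;> simp

end SymbolAlgebra

/-! ### Weyl pairs in rings of prime characteristic -/

section CharPIdentities

variable {E : Type*} [Ring E] {T D : E}

theorem mul_pow_of_weyl (h : D * T = T * D + 1) (m : ℕ) :
    D * T ^ m = T ^ m * D + m * T ^ (m - 1) := by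
  induction m with
  | zero => simp
  | succ m ih =>
    rw [pow_succ, ← mul_assoc, ih, add_mul, mul_assoc, h]
    rcases m with _ | m
    · simp
    · simp [mul_add, ← mul_assoc, pow_succ, add_mul]
      abel

theorem pow_mul_of_weyl (h : D * T = T * D + 1) (m : ℕ) :
    D ^ m * T = T * D ^ m + m * D ^ (m - 1) := by
  have h' : (-T) * D = D * (-T) + 1 := by rw [mul_neg, h, neg_mul]; abel
  have := mul_pow_of_weyl h' m
  rw [neg_mul, mul_neg] at this
  calc D ^ m * T = T * D ^ m + (-(T * D ^ m)) - (-(D ^ m * T)) := by abel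
    _ = _ := by rw [this]; abel

/-- The binomial coefficients of `p - 1` alternate modulo `p`. -/
theorem choose_prime_sub_one_cast {p : ℕ} (hp : p.Prime) (hE : (p : E) = 0) {l : ℕ} (hl : l < p) :
    ((p - 1).choose l : E) = (-1) ^ l := by
  induction l with
  | zero => simp
  | succ l ih =>
    have h1 : (p - 1).choose l + (p - 1).choose (l + 1) = p.choose (l + 1) := by
      obtain ⟨q, rfl⟩ : ∃ q, p = q + 1 := ⟨p - 1, by have := hp.pos; omega⟩
      exact (Nat.choose_succ_succ q l).symm
    obtain ⟨c, hc⟩ := hp.dvd_choose_self (Nat.succ_ne_zero l) hl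
    have h2 := congrArg (Nat.cast : ℕ → E) h1
    rw [Nat.succ_eq_add_one] at hc
    rw [hc] at h2
    push_cast at h2
    rw [hE, zero_mul, ih (by omega), add_comm, add_eq_zero_iff_eq_neg] at h2
    rw [h2, pow_succ, mul_neg_one]

/-- If `[D, T] = 1` in a ring of odd prime characteristic `p`, then
`∑ T ^ (p - 1 - l) D ^ (p - 1) T ^ l = -1`: the left-hand side is `(ad T) ^ (p - 1) (D ^ (p - 1))`,
which is `(p - 1)!`. -/
theorem sum_pow_mul_pow_mul_pow {p : ℕ} (hp : p.Prime) (hodd : Odd p) (hE : (p : E) = 0)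
    (h : D * T = T * D + 1) :
    ∑ l ∈ Finset.range p, T ^ (p - 1 - l) * D ^ (p - 1) * T ^ l + 1 = 0 := by
  have hp1 : p - 1 + 1 = p := Nat.sub_add_cancel hp.pos
  let L : Module.End ℤ E := LinearMap.mulLeft ℤ T
  let R : Module.End ℤ E := - LinearMap.mulRight ℤ T
  have hLR : Commute R L := (LinearMap.commute_mulLeft_right T T).symm.neg_left
  have heven : Even (p - 1) := Nat.Odd.sub_odd hodd odd_one
  have hL : ∀ (m : ℕ) (x : E), (L ^ m) x = T ^ m * x := fun m x => by
    simp [L, LinearMap.pow_mulLeft]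
  have hR : ∀ (m : ℕ) (x : E), (R ^ m) x = (-1) ^ m * (x * T ^ m) := fun m x => by
    rcases Nat.even_or_odd m with hm | hm
    · simp [R, hm.neg_pow, LinearMap.pow_mulRight]
    · simp [R, hm.neg_pow, LinearMap.pow_mulRight]
  have h1 : ((R + L) ^ (p - 1)) (D ^ (p - 1)) =
      ∑ l ∈ Finset.range p, T ^ (p - 1 - l) * D ^ (p - 1) * T ^ l := by
    rw [hLR.add_pow, hp1, LinearMap.sum_apply]
    refine Finset.sum_congr rfl fun l hl => ?_
    rw [Finset.mem_range] at hl
    rw [← Nat.cast_comm, ← nsmul_eq_mul, LinearMap.smul_apply, Module.End.mul_apply, hL, hR,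
      nsmul_eq_mul, choose_prime_sub_one_cast hp hE hl, ← mul_assoc, ← mul_assoc, ← mul_assoc,
      ← pow_add, (Even.add_self l).neg_one_pow, one_mul, mul_assoc]
  have h2 : ∀ m ≤ p - 1, ((R + L) ^ m) (D ^ (p - 1)) =
      ((-1) ^ m * ((p - 1).descFactorial m : ℤ)) • D ^ (p - 1 - m) := by
    intro m hm
    induction m with
    | zero => simp
    | succ m ih =>
      have h3 : (R + L) (D ^ (p - 1 - m)) =
          (-((p - 1 - m : ℕ) : ℤ)) • D ^ (p - 1 - (m + 1)) := by
        have h4 : (R + L) (D ^ (p - 1 - m)) = T * D ^ (p - 1 - m) - D ^ (p - 1 - m) * T := by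
          simp [R, L]; abel
        rw [h4, pow_mul_of_weyl h, Nat.sub_add_eq, neg_smul, natCast_zsmul, nsmul_eq_mul]
        abel
      rw [pow_succ', Module.End.mul_apply, ih (by omega), map_zsmul, h3, smul_smul,
        Nat.descFactorial_succ, pow_succ]
      congr 1
      push_cast; ring
  rw [← h1, h2 _ le_rfl, heven.neg_one_pow, Nat.descFactorial_self, Nat.sub_self, pow_zero,
    one_mul, natCast_zsmul, nsmul_one]
  obtain ⟨c, hc⟩ : p ∣ (p - 1).factorial + 1 := by
    have := Fact.mk hp
    rw [← CharP.cast_eq_zero_iff (ZMod p) p]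
    push_cast
    rw [ZMod.wilsons_lemma]; simp
  have h3 := congrArg (Nat.cast : ℕ → E) hc
  push_cast at h3
  rw [hE, zero_mul] at h3
  exact h3

end CharPIdentities

/-- A subalgebra of `End F` is everything as soon as it contains an operator `P` with values in
the line through a cyclic vector and all the `Yᵢ` of a decomposition `-1 = ∑ Xᵢ P Yᵢ`. -/
theorem Subalgebra.eq_top_of_sum_mul_mul {R F I : Type*} [CommRing R] [AddCommGroup F] [Module R F]
    (S : Subalgebra R (Module.End R F)) {e₀ : F} (he : ∀ x, ∃ s ∈ S, s e₀ = x)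
    {P : Module.End R F} (hP : P ∈ S) (hPe : ∀ w, ∃ r : R, P w = r • e₀) (J : Finset I)
    (X Y : I → Module.End R F) (hY : ∀ i ∈ J, Y i ∈ S) (h1 : ∑ i ∈ J, X i * P * Y i + 1 = 0) :
    S = ⊤ := by
  rw [eq_top_iff]
  intro f _
  choose s hs hse using he
  have hf : ∑ i ∈ J, s (f (X i e₀)) * P * Y i + f = 0 := by
    have h2 := congrArg (fun g => f * g) h1
    simp only [mul_add, mul_one, mul_zero, Finset.mul_sum] at h2
    rw [← h2]
    congr 1
    refine Finset.sum_congr rfl fun i _ => ?_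
    ext w
    obtain ⟨r, hr⟩ := hPe (Y i w)
    simp [hr, hse]
  rw [eq_neg_of_add_eq_zero_right hf]
  exact S.neg_mem (S.sum_mem fun i hi => S.mul_mem (S.mul_mem (hs _) hP) (hY i hi))

namespace SymbolAlgebra

/-! ### One pair of generators -/

variable {R : Type*} [CommRing R] {p : ℕ}

section

variable (a b : Unit → R)

/-- The monomials `uⁱ vʲ` with `i, j < p`. -/
noncomputable def monomials (x : Fin p × Fin p) : SymbolAlgebra p a b :=
  u p a b () ^ (x.1 : ℕ) * v p a b () ^ (x.2 : ℕ)

/-- The monomials span, since their span is stable under left multiplication by the generators. -/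
theorem top_le_span_monomials (hp : 0 < p) :
    ⊤ ≤ Submodule.span R (Set.range (monomials (p := p) a b)) := by
  set M := Submodule.span R (Set.range (monomials (p := p) a b)) with hM
  have h := isWeylSystem p a b
  have hmem : ∀ i j : ℕ, u p a b () ^ i * v p a b () ^ j ∈ M := by
    intro i j
    have hi : u p a b () ^ i = a () ^ (i / p) • u p a b () ^ (i % p) := by
      conv_lhs => rw [← Nat.div_add_mod i p, pow_add, pow_mul, h.u_pow, ← map_pow,
        ← Algebra.smul_def]
    have hj : v p a b () ^ j = b () ^ (j / p) • v p a b () ^ (j % p) := by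
      conv_lhs => rw [← Nat.div_add_mod j p, pow_add, pow_mul, h.v_pow, ← map_pow,
        ← Algebra.smul_def]
    rw [hi, hj, smul_mul_smul_comm]
    exact M.smul_mem _ (Submodule.subset_span
      ⟨(⟨i % p, Nat.mod_lt _ hp⟩, ⟨j % p, Nat.mod_lt _ hp⟩), rfl⟩)
  have hmul : ∀ w : SymbolAlgebra p a b, ∀ m ∈ M, w * m ∈ M := by
    intro w
    induction w using induction with
    | hr r => intro m hm; rw [← Algebra.smul_def]; exact M.smul_mem r hm
    | hmul x y hx hy => intro m hm; rw [mul_assoc]; exact hx _ (hy _ hm)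
    | hadd x y hx hy => intro m hm; rw [add_mul]; exact M.add_mem (hx _ hm) (hy _ hm)
    | hu i =>
      intro m hm
      induction hm using Submodule.span_induction with
      | zero => simp
      | add x y _ _ hx hy => rw [mul_add]; exact M.add_mem hx hy
      | smul r x _ hx => rw [mul_smul_comm]; exact M.smul_mem r hx
      | mem x hx =>
        obtain ⟨⟨i, j⟩, rfl⟩ := hx
        rw [monomials, ← mul_assoc, ← pow_succ']
        exact hmem _ _
    | hv i =>
      intro m hm
      induction hm using Submodule.span_induction with
      | zero => simp
      | add x y _ _ hx hy => rw [mul_add]; exact M.add_mem hx hy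
      | smul r x _ hx => rw [mul_smul_comm]; exact M.smul_mem r hx
      | mem x hx =>
        obtain ⟨⟨i, j⟩, rfl⟩ := hx
        rw [monomials, ← mul_assoc, mul_pow_of_weyl (h.vu_self ()), add_mul, mul_assoc, ← pow_succ',
          ← nsmul_eq_mul, smul_mul_assoc]
        exact M.add_mem (hmem _ _) (M.nsmul_mem (hmem _ _) _)
  intro w _
  have h1 : (1 : SymbolAlgebra p a b) ∈ M := by simpa using hmem 0 0
  simpa using hmul w 1 h1

end

section

open Polynomial

variable (b : R)

theorem monic_X_pow_sub_C' (hp : 0 < p) : (X ^ p - C b : R[X]).Monic :=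
  monic_X_pow_sub_C b hp.ne'

/-- The module `R[T] / (Tᵖ - b)`, on which `u` acts as `T` and `v` as `d/dT`. -/
abbrev TruncPoly (p : ℕ) (b : R) : Type _ := AdjoinRoot (X ^ p - C b : R[X])

/-- The derivation `d/dT` of `R[T] / (Tᵖ - b)`, well defined in characteristic `p`. -/
noncomputable def truncDeriv (hp : 0 < p) : Module.End R (TruncPoly p b) :=
  (AdjoinRoot.mkₐ _).toLinearMap ∘ₗ derivative ∘ₗ
    AdjoinRoot.modByMonicHom (monic_X_pow_sub_C' b hp)

variable {b}

theorem truncDeriv_mk [CharP R p] (hp : 0 < p) (q : R[X]) :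
    truncDeriv b hp (AdjoinRoot.mk _ q) = AdjoinRoot.mk _ (derivative q) := by
  have h : derivative q = derivative (q %ₘ (X ^ p - C b)) +
      (X ^ p - C b) * derivative (q /ₘ (X ^ p - C b)) := by
    conv_lhs => rw [← modByMonic_add_div q (X ^ p - C b)]
    simp [derivative_X_pow]
  change AdjoinRoot.mk _ (derivative (q %ₘ (X ^ p - C b))) = _
  rw [h, map_add, map_mul, AdjoinRoot.mk_self, zero_mul, add_zero]

theorem truncDeriv_pow_mk [CharP R p] (hp : 0 < p) (m : ℕ) (q : R[X]) :
    (truncDeriv b hp ^ m) (AdjoinRoot.mk _ q) = AdjoinRoot.mk _ (derivative^[m] q) := by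
  induction m generalizing q with
  | zero => rfl
  | succ m ih => rw [pow_succ, Module.End.mul_apply, truncDeriv_mk, ih, Function.iterate_succ_apply]

theorem exists_natDegree_lt [Nontrivial R] (hp : 1 < p) (x : TruncPoly p b) :
    ∃ q : R[X], q.natDegree < p ∧ AdjoinRoot.mk _ q = x := by
  have hm := monic_X_pow_sub_C' b (zero_lt_one.trans hp)
  refine ⟨AdjoinRoot.modByMonicHom hm x, ?_, AdjoinRoot.mk_leftInverse hm x⟩
  obtain ⟨q, rfl⟩ := AdjoinRoot.mk_surjective x
  rw [AdjoinRoot.modByMonicHom_mk]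
  have hdeg : (X ^ p - C b : R[X]).natDegree = p := natDegree_X_pow_sub_C
  have := natDegree_modByMonic_lt q hm (fun h => by
    rw [h, natDegree_one] at hdeg; omega)
  rwa [hdeg] at this

theorem truncDeriv_weyl [CharP R p] (hp : 0 < p) :
    truncDeriv b hp * Algebra.lmul R _ (AdjoinRoot.root _) =
      Algebra.lmul R _ (AdjoinRoot.root _) * truncDeriv b hp + 1 := by
  have h : ∀ x : TruncPoly p b, truncDeriv b hp (AdjoinRoot.root _ * x) =
      AdjoinRoot.root _ * truncDeriv b hp x + x := by
    intro x
    obtain ⟨q, rfl⟩ := AdjoinRoot.mk_surjective x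
    rw [← AdjoinRoot.mk_X, ← map_mul, truncDeriv_mk, truncDeriv_mk, derivative_mul, derivative_X,
      one_mul, map_add, map_mul, add_comm]
  exact LinearMap.ext h

variable (b) in
/-- The differential operators `u = T` and `v = d/dT` on `R[T] / (Tᵖ - b)`. -/
theorem isWeylSystem_truncPoly [CharP R p] [hp : Fact p.Prime] :
    IsWeylSystem p (fun _ : Unit => b) (fun _ => (0 : R))
      (fun _ => Algebra.lmul R (TruncPoly p b) (AdjoinRoot.root _))
      (fun _ => truncDeriv b hp.1.pos) where
  uu _ _ := rfl
  vv _ _ := rfl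
  vu_self _ := truncDeriv_weyl hp.1.pos
  vu_ne i j h := absurd rfl h
  u_pow _ := by
    rw [← map_pow]
    have h : (AdjoinRoot.root (X ^ p - C b)) ^ p = algebraMap R _ b := by
      have := AdjoinRoot.mk_self (f := X ^ p - C b)
      rw [map_sub, map_pow, AdjoinRoot.mk_X, sub_eq_zero] at this
      exact this
    rw [h, AlgHom.commutes]
  v_pow _ := by
    have := CharP.nontrivial_of_char_ne_one (R := R) hp.1.ne_one
    rw [map_zero]
    refine LinearMap.ext fun x => ?_
    obtain ⟨q, hq, rfl⟩ := exists_natDegree_lt hp.1.one_lt x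
    rw [truncDeriv_pow_mk, iterate_derivative_eq_zero hq, map_zero]
    rfl

instance [hp : Fact p.Prime] : Module.Free R (TruncPoly p b) :=
  .of_basis (AdjoinRoot.powerBasis' (monic_X_pow_sub_C' b hp.1.pos)).basis

instance [hp : Fact p.Prime] : Module.Finite R (TruncPoly p b) :=
  (AdjoinRoot.powerBasis' (monic_X_pow_sub_C' b hp.1.pos)).finite

theorem finrank_truncPoly [Nontrivial R] [hp : Fact p.Prime] :
    Module.finrank R (TruncPoly p b) = p := by
  rw [(AdjoinRoot.powerBasis' (monic_X_pow_sub_C' b hp.1.pos)).finrank, AdjoinRoot.powerBasis'_dim,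
    natDegree_X_pow_sub_C]

/-- Every endomorphism of `R[T] / (Tᵖ - b)` is a differential operator: `Dᵖ⁻¹` takes values in the
constants, so `Subalgebra.eq_top_of_sum_mul_mul` applies. -/
theorem lift_truncPoly_surjective [CharP R p] [hp : Fact p.Prime] (hodd : Odd p) :
    Function.Surjective (lift (isWeylSystem_truncPoly (p := p) b)) := by
  have := CharP.nontrivial_of_char_ne_one (R := R) hp.1.ne_one
  set f := lift (isWeylSystem_truncPoly (p := p) b) with hf
  set T := Algebra.lmul R (TruncPoly p b) (AdjoinRoot.root _) with hT
  set D := truncDeriv b hp.1.pos with hD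
  have hTmem : T ∈ f.range := ⟨u p _ _ (), lift_u _ ()⟩
  have hDmem : D ∈ f.range := ⟨v p _ _ (), lift_v _ ()⟩
  rw [← AlgHom.range_eq_top]
  refine Subalgebra.eq_top_of_sum_mul_mul f.range (e₀ := 1) ?_ (P := D ^ (p - 1))
    (pow_mem hDmem _) ?_ (Finset.range p) (fun l => T ^ (p - 1 - l)) (fun l => T ^ l)
    (fun l _ => pow_mem hTmem l) ?_
  · intro x
    obtain ⟨q, rfl⟩ := AdjoinRoot.mk_surjective x
    refine ⟨aeval T q, ?_, ?_⟩
    · exact Algebra.adjoin_le (Set.singleton_subset_iff.2 hTmem)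
        (aeval_mem_adjoin_singleton R T)
    · rw [hT, aeval_algHom_apply, ← AdjoinRoot.aeval_eq]
      exact mul_one _
  · intro x
    obtain ⟨q, hq, rfl⟩ := exists_natDegree_lt hp.1.one_lt x
    rw [truncDeriv_pow_mk]
    have h0 : (derivative^[p - 1] q).natDegree = 0 := by
      have := natDegree_iterate_derivative q (p - 1)
      omega
    rw [eq_C_of_natDegree_eq_zero h0]
    refine ⟨(derivative^[p - 1] q).coeff 0, ?_⟩
    rw [Algebra.smul_def, mul_one]
    rfl
  · have hE : (p : Module.End R (TruncPoly p b)) = 0 := by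
      rw [← map_natCast (algebraMap R _), CharP.cast_eq_zero, map_zero]
    exact sum_pow_mul_pow_mul_pow hp.1 hodd hE (truncDeriv_weyl (b := b) hp.1.pos)

end

/-- A linear combination of `p ^ 2` monomials. -/
noncomputable def ofCoeffs (a b : Unit → R) : (Fin p × Fin p → R) →ₗ[R] SymbolAlgebra p a b :=
  Fintype.linearCombination R (monomials a b)

theorem ofCoeffs_surjective (hp : 0 < p) (a b : Unit → R) :
    Function.Surjective (ofCoeffs (p := p) a b) := by
  rw [← LinearMap.range_eq_top, ofCoeffs, Fintype.range_linearCombination, eq_top_iff]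
  exact top_le_span_monomials a b hp

/-- The symbol algebra with `b = 0` is split. -/
noncomputable def zeroEquiv [CharP R p] [hp : Fact p.Prime] (hodd : Odd p) (b : Unit → R) :
    SymbolAlgebra p b 0 ≃ₐ[R] Module.End R (TruncPoly p (b ())) := by
  refine AlgEquiv.ofBijective (lift (isWeylSystem_truncPoly (p := p) (b ()))) ⟨?_, ?_⟩
  · have := CharP.nontrivial_of_char_ne_one (R := R) hp.1.ne_one
    have h1 := ofCoeffs_surjective hp.1.pos b 0
    have h2 := (lift_truncPoly_surjective (b := b ()) hodd).comp h1
    have h3 := OrzechProperty.bijective_of_surjective_of_finrank_le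
      ((lift (isWeylSystem_truncPoly (p := p) (b ()))).toLinearMap ∘ₗ ofCoeffs b 0) h2 (by
        simp [Module.finrank_linearMap, finrank_truncPoly])
    exact Function.Injective.of_comp_right h3.1 h1
  · exact lift_truncPoly_surjective hodd

end SymbolAlgebra

/-! ### The Azumaya property for one pair of generators -/

/-- If `M ⊗ N → A ⊗ B` is induced by surjections from finite free modules `M`, `N`, and `A ⊗ B` is
free of at least the rank of `M ⊗ N`, then `M → A` is bijective. -/
theorem bijective_of_finrank_le_finrank_tensorProduct {R M N A B : Type*} [CommRing R]
    [Nontrivial R] [AddCommGroup M] [AddCommGroup N] [AddCommGroup A] [AddCommGroup B] [Module R M]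
    [Module R N] [Module R A] [Module R B] [Module.Free R M] [Module.Finite R M] [Module.Free R N]
    [Module.Finite R N] [Nontrivial N] [Module.Free R (A ⊗[R] B)]
    {f : M →ₗ[R] A} {g : N →ₗ[R] B} (hf : Function.Surjective f) (hg : Function.Surjective g)
    (h : Module.finrank R M * Module.finrank R N ≤ Module.finrank R (A ⊗[R] B)) :
    Function.Bijective f := by
  refine ⟨?_, hf⟩
  have : Module.Finite R A := .of_surjective f hf
  have : Module.Finite R B := .of_surjective g hg
  have hb := OrzechProperty.bijective_of_surjective_of_finrank_le (TensorProduct.map f g)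
    (TensorProduct.map_surjective hf hg) (by rwa [Module.finrank_tensorProduct])
  rw [injective_iff_map_eq_zero]
  intro x hx
  let bN := Module.Free.chooseBasis R N
  obtain ⟨i⟩ : Nonempty (Module.Free.ChooseBasisIndex R N) := bN.index_nonempty
  have h1 : x ⊗ₜ[R] bN i = 0 := by
    apply hb.1
    rw [TensorProduct.map_tmul, hx, TensorProduct.zero_tmul, map_zero]
  have h2 := congrArg ((TensorProduct.rid R M).toLinearMap ∘ₗ
    TensorProduct.map LinearMap.id (bN.coord i)) h1
  simpa using h2

/-- If `A` is central and generated by `x` and `y` with `[y, x] = 1`, `xᵖ, yᵖ ∈ R`, then the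
multiplication operators and the inner derivations `[y, ·]` and `[·, x]` generate all endomorphisms
of `A`. -/
theorem mulLeftRight_surjective_of_weyl {R A : Type*} [CommRing R] {p : ℕ} [CharP R p]
    [hp : Fact p.Prime] [Ring A] [Algebra R A] [Algebra.IsCentral R A] (hodd : Odd p) {x y : A}
    {a b : R} (hyx : y * x = x * y + 1) (hx : x ^ p = algebraMap R A a)
    (hy : y ^ p = algebraMap R A b)
    (hgen : ∀ z, x * z = z * x → y * z = z * y → ∀ t, t * z = z * t) :
    Function.Surjective (AlgHom.mulLeftRight R A) := by
  set S := (AlgHom.mulLeftRight R A).range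
  let l : A → Module.End R A := fun z => LinearMap.mulLeft R z
  let r : A → Module.End R A := fun z => LinearMap.mulRight R z
  have hl : ∀ z, l z ∈ S := fun z => ⟨z ⊗ₜ 1, by ext w; simp [l]⟩
  have hr : ∀ z, r z ∈ S := fun z => ⟨1 ⊗ₜ MulOpposite.op z, by ext w; simp [r]⟩
  let D₁ := l y - r y
  let D₂ := r x - l x
  have hD₁ : ∀ w, D₁ w = y * w - w * y := fun w => rfl
  have hD₂ : ∀ w, D₂ w = w * x - x * w := fun w => rfl
  have hD₁mem : D₁ ∈ S := S.sub_mem (hl y) (hr y)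
  have hD₂mem : D₂ ∈ S := S.sub_mem (hr x) (hl x)
  have h11 : D₁ * l x = l x * D₁ + 1 := by
    refine LinearMap.ext fun w => ?_
    change y * (x * w) - x * w * y = x * (y * w - w * y) + w
    rw [← mul_assoc, hyx, add_mul, mul_sub, one_mul, mul_assoc, mul_assoc]; abel
  have h22 : D₂ * r y = r y * D₂ + 1 := by
    refine LinearMap.ext fun w => ?_
    change w * y * x - x * (w * y) = (w * x - x * w) * y + w
    rw [mul_assoc w, hyx, mul_add, sub_mul, mul_one]; noncomm_ring
  have h12 : Commute D₁ (r y) := by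
    refine LinearMap.ext fun w => ?_
    change y * (w * y) - w * y * y = (y * w - w * y) * y
    noncomm_ring
  have hDD : Commute D₁ D₂ := by
    refine LinearMap.ext fun w => ?_
    change y * (w * x - x * w) - (w * x - x * w) * y = (y * w - w * y) * x - x * (y * w - w * y)
    have h1 : w * y * x = w * x * y + w := by rw [mul_assoc, hyx]; noncomm_ring
    have h2 : y * x * w = x * y * w + w := by rw [hyx]; noncomm_ring
    simp only [mul_sub, sub_mul, ← mul_assoc, h1, h2]
    abel
  have h21 : Commute D₂ (l x) := by
    refine LinearMap.ext fun w => ?_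
    change x * w * x - x * (x * w) = x * (w * x - x * w)
    noncomm_ring
  have hlr : Commute (l x) (r y) := LinearMap.commute_mulLeft_right x y
  have hE : (p : Module.End R A) = 0 := by
    rw [← map_natCast (algebraMap R _), CharP.cast_eq_zero, map_zero]
  have s1 := sum_pow_mul_pow_mul_pow hp.1 hodd hE h11
  have s2 := sum_pow_mul_pow_mul_pow hp.1 hodd hE h22
  have hlp : ∀ z : A, l z ^ p = l (z ^ p) := fun z => by simp [l, LinearMap.pow_mulLeft]
  have hrp : ∀ z : A, r z ^ p = r (z ^ p) := fun z => by simp [r, LinearMap.pow_mulRight]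
  have hlcr : ∀ c : R, l (algebraMap R A c) = r (algebraMap R A c) := fun c => by
    exact LinearMap.ext fun w => Algebra.commutes c w
  -- the inner derivations have trivial `p`-th power because `xᵖ` and `yᵖ` are central
  have hD₁p : D₁ ^ p = 0 := by
    rw [sub_pow_of_commute_of_algebra (R := R) (LinearMap.commute_mulLeft_right y y), hlp, hrp,
      hy, hlcr, sub_self]
  have hD₂p : D₂ ^ p = 0 := by
    rw [sub_pow_of_commute_of_algebra (R := R) (LinearMap.commute_mulLeft_right x x).symm, hlp, hrp,
      hx, hlcr, sub_self]
  have hp1 : p - 1 + 1 = p := Nat.sub_add_cancel hp.1.pos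
  rw [← AlgHom.range_eq_top]
  refine Subalgebra.eq_top_of_sum_mul_mul S (e₀ := 1) (fun w => ⟨l w, hl w, mul_one w⟩)
    (P := D₁ ^ (p - 1) * D₂ ^ (p - 1)) (mul_mem (pow_mem hD₁mem _) (pow_mem hD₂mem _)) ?_
    (Finset.range p ×ˢ Finset.range p)
    (fun i => algebraMap R _ (-1) * (l x ^ (p - 1 - i.1) * r y ^ (p - 1 - i.2)))
    (fun i => l x ^ i.1 * r y ^ i.2)
    (fun i _ => mul_mem (pow_mem (hl x) _) (pow_mem (hr y) _)) ?_
  · intro w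
    set z := (D₁ ^ (p - 1) * D₂ ^ (p - 1)) w with hz
    have hz1 : D₁ z = 0 := by
      rw [hz, ← Module.End.mul_apply, ← mul_assoc, ← pow_succ', hp1, hD₁p, zero_mul]
      rfl
    have hz2 : D₂ z = 0 := by
      rw [hz, (hDD.pow_pow _ _).eq, ← Module.End.mul_apply, ← mul_assoc, ← pow_succ', hp1, hD₂p,
        zero_mul]
      rfl
    rw [hD₁, sub_eq_zero] at hz1
    rw [hD₂, sub_eq_zero] at hz2
    have hzc : z ∈ Subalgebra.center R A := by
      rw [Subalgebra.mem_center_iff]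
      exact hgen z hz2.symm hz1
    rw [Algebra.IsCentral.center_eq_bot, Algebra.mem_bot] at hzc
    obtain ⟨c, hc⟩ := hzc
    exact ⟨c, by rw [← hc, Algebra.algebraMap_eq_smul_one]⟩
  · have hterm : ∀ i : ℕ × ℕ, algebraMap R (Module.End R A) (-1) *
        (l x ^ (p - 1 - i.1) * r y ^ (p - 1 - i.2)) * (D₁ ^ (p - 1) * D₂ ^ (p - 1)) *
        (l x ^ i.1 * r y ^ i.2) = algebraMap R (Module.End R A) (-1) *
        ((l x ^ (p - 1 - i.1) * D₁ ^ (p - 1) * l x ^ i.1) *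
          (r y ^ (p - 1 - i.2) * D₂ ^ (p - 1) * r y ^ i.2)) := by
      intro i
      have c1 := (h12.pow_pow (p - 1) (p - 1 - i.2)).eq
      have c2 := (h21.pow_pow (p - 1) i.1).eq
      have c3 := (hlr.pow_pow i.1 (p - 1 - i.2)).eq
      simp only [mul_assoc]
      congr 2
      rw [← mul_assoc (r y ^ _) (D₁ ^ _), ← c1, mul_assoc, ← mul_assoc (D₂ ^ _) (l x ^ _), c2]
      simp only [mul_assoc]
      congr 1
      rw [← mul_assoc (r y ^ _) (l x ^ _), ← c3]
      simp only [mul_assoc]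
    rw [Finset.sum_congr rfl fun i _ => hterm i, ← Finset.mul_sum, Finset.sum_product]
    simp only [← Finset.mul_sum]
    rw [← Finset.sum_mul]
    have h1 : algebraMap R (Module.End R A) (-1) + 1 = 0 := by
      rw [← map_one (algebraMap R (Module.End R A)), ← map_add, neg_add_cancel, map_zero]
    have aux : ∀ {E : Type _} [Ring E] {e s t : E}, e + 1 = 0 → s + 1 = 0 → t + 1 = 0 →
        e * (s * t) + 1 = 0 := by
      intro E _ e s t he hs ht
      rw [eq_neg_of_add_eq_zero_left he, eq_neg_of_add_eq_zero_left hs,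
        eq_neg_of_add_eq_zero_left ht, neg_mul_neg, one_mul, mul_one, neg_add_cancel]
    exact aux h1 s1 s2

namespace SymbolAlgebra

variable {R : Type*} [CommRing R] {p : ℕ} [CharP R p] [hp : Fact p.Prime]

/-- The product of the symbols with values `(a, b)` and `(a, -b)` is split. -/
noncomputable def tensorNegEquiv (hodd : Odd p) (a b : Unit → R) :
    SymbolAlgebra p a b ⊗[R] SymbolAlgebra p a (-b) ≃ₐ[R]
      Module.End R (TruncPoly p (a ()) ⊗[R] TruncPoly p (-b ())) := by
  have e := tensorEquiv (p := p) a b (-b)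
  rw [add_neg_cancel] at e
  have e' := swap hodd (0 : Unit → R) (-b)
  rw [neg_zero] at e'
  exact e.trans ((Algebra.TensorProduct.congr (zeroEquiv hodd a)
    (e'.trans (zeroEquiv hodd (-b)))).trans (BrauerAux.endTensorEnd _ _))

/-- The `p²` monomials form a basis: by `tensorNegEquiv` the tensor product with the inverse symbol is
free of rank `p⁴`, which leaves no room for relations. -/
theorem ofCoeffs_bijective (hodd : Odd p) (a b : Unit → R) :
    Function.Bijective (ofCoeffs (p := p) a b) := by
  have := CharP.nontrivial_of_char_ne_one (R := R) hp.1.ne_one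
  have : NeZero p := ⟨hp.1.ne_zero⟩
  have : Nonempty (Fin p × Fin p) := ⟨0, 0⟩
  let e := (tensorNegEquiv (p := p) hodd a b).toLinearEquiv
  have : Module.Free R (SymbolAlgebra p a b ⊗[R] SymbolAlgebra p a (-b)) := .of_equiv e.symm
  refine bijective_of_finrank_le_finrank_tensorProduct (ofCoeffs_surjective hp.1.pos a b)
    (ofCoeffs_surjective hp.1.pos a (-b)) ?_
  rw [e.finrank_eq]
  simp [Module.finrank_linearMap, finrank_truncPoly]

theorem free_unit (hodd : Odd p) (a b : Unit → R) : Module.Free R (SymbolAlgebra p a b) :=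
  .of_equiv (LinearEquiv.ofBijective _ (ofCoeffs_bijective hodd a b))

theorem finite_unit (hodd : Odd p) (a b : Unit → R) : Module.Finite R (SymbolAlgebra p a b) :=
  .equiv (LinearEquiv.ofBijective _ (ofCoeffs_bijective hodd a b))

theorem nontrivial_unit (hodd : Odd p) (a b : Unit → R) : Nontrivial (SymbolAlgebra p a b) := by
  have := CharP.nontrivial_of_char_ne_one (R := R) hp.1.ne_one
  have : NeZero p := ⟨hp.1.ne_zero⟩
  have : Nonempty (Fin p × Fin p) := ⟨0, 0⟩
  exact (ofCoeffs_bijective hodd a b).1.nontrivial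

/-- The symbol algebra is central, as a tensor factor of an endomorphism algebra. -/
theorem isCentral_unit (hodd : Odd p) (a b : Unit → R) :
    Algebra.IsCentral R (SymbolAlgebra p a b) := by
  have := free_unit hodd a b
  have := free_unit hodd a (-b)
  have := nontrivial_unit hodd a (-b)
  have : Algebra.IsCentral R (SymbolAlgebra p a b ⊗[R] SymbolAlgebra p a (-b)) :=
    .of_algEquiv R _ _ (tensorNegEquiv (p := p) hodd a b).symm
  exact Algebra.IsCentral.left_of_tensor R _ (SymbolAlgebra p a (-b))
    (FaithfulSMul.algebraMap_injective _ _)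

theorem isAzumaya_unit (hodd : Odd p) (a b : Unit → R) : IsAzumaya R (SymbolAlgebra p a b) := by
  have := free_unit hodd a b
  have := finite_unit hodd a b
  have := nontrivial_unit hodd a b
  have : Module.Free R (SymbolAlgebra p a b)ᵐᵒᵖ := .of_equiv (MulOpposite.opLinearEquiv R)
  have : Module.Finite R (SymbolAlgebra p a b)ᵐᵒᵖ := .equiv (MulOpposite.opLinearEquiv R)
  have := CharP.nontrivial_of_char_ne_one (R := R) hp.1.ne_one
  have := isCentral_unit hodd a b
  have h := isWeylSystem p a b
  have hs := mulLeftRight_surjective_of_weyl hodd (h.vu_self ()) (h.u_pow ()) (h.v_pow ())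
    fun z hx hy => commute_of_commute (AlgHom.id R _) (t := z) (fun _ => hx) (fun _ => hy)
  have hfaith : FaithfulSMul R (SymbolAlgebra p a b) := inferInstance
  refine ⟨OrzechProperty.bijective_of_surjective_of_finrank_le
    (AlgHom.mulLeftRight R (SymbolAlgebra p a b)).toLinearMap hs ?_⟩
  rw [Module.finrank_tensorProduct, Module.finrank_linearMap,
    (MulOpposite.opLinearEquiv R (M := SymbolAlgebra p a b)).finrank_eq]

end SymbolAlgebra

/-! ### Several pairs of generators -/

namespace SymbolAlgebra

variable {R : Type u} [CommRing R] {p : ℕ} [CharP R p] [hp : Fact p.Prime]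

/-- A symbol algebra without generators is the base ring. -/
noncomputable def isEmptyEquiv {ι : Type} [IsEmpty ι] (a b : ι → R) :
    SymbolAlgebra p a b ≃ₐ[R] R :=
  AlgEquiv.ofAlgHom (lift (u := fun i => isEmptyElim i) (v := fun i => isEmptyElim i)
    ⟨fun i => isEmptyElim i, fun i => isEmptyElim i, fun i => isEmptyElim i,
      fun i => isEmptyElim i, fun i => isEmptyElim i, fun i => isEmptyElim i⟩) (Algebra.ofId R _)
    (by ext) (algHom_ext (fun i => isEmptyElim i) (fun i => isEmptyElim i))

/-- Splitting off one pair of generators. -/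
noncomputable def optionEquiv {ι : Type} (a b : Option ι → R) :
    SymbolAlgebra p a b ≃ₐ[R] SymbolAlgebra p (a ∘ some) (b ∘ some) ⊗[R]
      SymbolAlgebra p (fun _ : Unit => a none) (fun _ => b none) := by
  have e := sumEquiv (p := p) (a ∘ some) (b ∘ some) (fun _ : Unit => a none) (fun _ => b none)
  have e' := reindex (p := p) (Equiv.optionEquivSumPUnit ι).symm a b
  have h : ∀ c : Option ι → R, c ∘ (Equiv.optionEquivSumPUnit.{0} ι).symm =
      Sum.elim (c ∘ some) (fun _ : Unit => c none) := by
    intro c; ext (i | i) <;> rfl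
  rw [h, h] at e'
  exact e'.symm.trans e

theorem free_and_isAzumaya (hodd : Odd p) (ι : Type) [Finite ι] (a b : ι → R) :
    Module.Free R (SymbolAlgebra p a b) ∧ IsAzumaya R (SymbolAlgebra p a b) := by
  induction ι using Finite.induction_empty_option with
  | of_equiv e h =>
    obtain ⟨h1, h2⟩ := h (a ∘ e) (b ∘ e)
    exact ⟨.of_equiv (reindex e a b).toLinearEquiv, .of_AlgEquiv R _ _ (reindex e a b)⟩
  | h_empty =>
    exact ⟨.of_equiv (isEmptyEquiv a b).symm.toLinearEquiv,
      .of_AlgEquiv R R _ (isEmptyEquiv a b).symm⟩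
  | h_option h =>
    obtain ⟨h1, h2⟩ := h (a ∘ some) (b ∘ some)
    have h3 : Module.Free R (SymbolAlgebra p (fun _ : Unit => a none) (fun _ => b none)) :=
      free_unit hodd _ _
    have h4 : IsAzumaya R (SymbolAlgebra p (fun _ : Unit => a none) (fun _ => b none)) :=
      isAzumaya_unit hodd _ _
    have h5 : IsAzumaya R (SymbolAlgebra p (a ∘ some) (b ∘ some) ⊗[R]
      SymbolAlgebra p (fun _ : Unit => a none) (fun _ => b none)) :=
      AzumayaAlgebra.isAzumaya_tensor _ _
    exact ⟨.of_equiv (optionEquiv a b).symm.toLinearEquiv,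
      IsAzumaya.of_AlgEquiv R _ _ (optionEquiv a b).symm⟩

theorem _root_.BrauerEquiv.end_self (V : Type u) [AddCommGroup V] [Module R V] [Module.Finite R V]
    [Module.Projective R V] [FaithfulSMul R V] : BrauerEquiv R (Module.End R V) R :=
  ⟨R, V, inferInstance, inferInstance, inferInstance, inferInstance,
    ⟨inferInstance, inferInstance, inferInstance⟩, ⟨inferInstance, inferInstance, inferInstance⟩,
    ⟨(Algebra.TensorProduct.congr AlgEquiv.refl
      ((AlgEquiv.moduleEndSelf R (A := R)).symm.trans (AlgEquiv.toOpposite R R).symm)).trans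
      (Algebra.TensorProduct.comm R _ _)⟩⟩

theorem brauerEquiv_zero_unit (hodd : Odd p) (b : Unit → R) :
    BrauerEquiv R (SymbolAlgebra p 0 b) R := by
  have := CharP.nontrivial_of_char_ne_one (R := R) hp.1.ne_one
  have : Nontrivial (TruncPoly p (b ())) := by
    apply Module.nontrivial_of_finrank_pos (R := R)
    rw [finrank_truncPoly]
    exact hp.1.pos
  have e := swap hodd 0 b
  refine (BrauerEquiv.of_algEquiv (e.trans ?_)).trans
    (BrauerEquiv.end_self (TruncPoly p (b ())))
  rw [neg_zero]
  exact zeroEquiv hodd b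

/-- A symbol algebra with `a = 0` has trivial Brauer class. -/
theorem brauerEquiv_zero (hodd : Odd p) (ι : Type) [Finite ι] (b : ι → R) :
    BrauerEquiv R (SymbolAlgebra p 0 b) R := by
  induction ι using Finite.induction_empty_option with
  | of_equiv e h => exact (BrauerEquiv.of_algEquiv (reindex e 0 b).symm).trans (h (b ∘ e))
  | h_empty => exact .of_algEquiv (isEmptyEquiv 0 b)
  | h_option h =>
    exact (BrauerEquiv.of_algEquiv (optionEquiv 0 b)).trans
      (((h (b ∘ some)).tensor (brauerEquiv_zero_unit hodd fun _ => b none)).trans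
        (.of_algEquiv (Algebra.TensorProduct.lid R R)))

/-- The addition law for symbols in the Brauer group. -/
theorem brauerEquiv_add (hodd : Odd p) {ι : Type} [Finite ι] (a b b' : ι → R) :
    BrauerEquiv R (SymbolAlgebra p a b ⊗[R] SymbolAlgebra p a b') (SymbolAlgebra p a (b + b')) :=
  (BrauerEquiv.of_algEquiv (tensorEquiv a b b')).trans
    ((BrauerEquiv.refl.tensor (brauerEquiv_zero hodd ι b')).trans
      (.of_algEquiv (Algebra.TensorProduct.rid R R _)))

end SymbolAlgebra

/-! ### The Weyl algebra as a symbol algebra -/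

namespace WeylAlgebra

variable {k : Type u} [Field k] {n : ℕ}

/-- The universal property of the Weyl algebra. -/
noncomputable def lift {B : Type*} [Ring B] [Algebra k B] (f : Fin n ⊕ Fin n → B)
    (hf : ∀ i j, f i * f j - f j * f i = algebraMap k B (weylForm k n i j)) :
    WeylAlgebra k n →ₐ[k] B :=
  RingQuot.liftAlgHom k ⟨FreeAlgebra.lift k f, by
    rintro _ _ ⟨i, j⟩
    simpa using hf i j⟩

theorem lift_x {B : Type*} [Ring B] [Algebra k B] (f : Fin n ⊕ Fin n → B)
    (hf : ∀ i j, f i * f j - f j * f i = algebraMap k B (weylForm k n i j)) (i : Fin n ⊕ Fin n) :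
    lift f hf (x k n i) = f i := by
  simp only [lift, x, mk]
  exact (RingQuot.liftAlgHom_mkAlgHom_apply k _ _ _).trans (by simp)

/-- Induction principle: a property that holds for scalars and generators and is stable under
sums and products holds everywhere. -/
theorem induction {P : WeylAlgebra k n → Prop} (hr : ∀ r, P (algebraMap k _ r))
    (hx : ∀ i, P (x k n i)) (hmul : ∀ a b, P a → P b → P (a * b))
    (hadd : ∀ a b, P a → P b → P (a + b)) (a : WeylAlgebra k n) : P a := by
  obtain ⟨a, rfl⟩ : ∃ a', mk k n a' = a := RingQuot.mkAlgHom_surjective k (WeylRel k n) a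
  induction a using FreeAlgebra.induction with
  | grade0 r => rw [AlgHom.commutes]; exact hr r
  | grade1 i => exact hx i
  | mul a b ha hb => rw [map_mul]; exact hmul _ _ ha hb
  | add a b ha hb => rw [map_add]; exact hadd _ _ ha hb

theorem ringHom_ext {B : Type*} [Semiring B] {f g : WeylAlgebra k n →+* B}
    (hr : ∀ r, f (algebraMap k _ r) = g (algebraMap k _ r)) (hx : ∀ i, f (x k n i) = g (x k n i)) :
    f = g := by
  ext a
  induction a using induction with
  | hr r => exact hr r
  | hx i => exact hx i
  | hmul a b ha hb => rw [map_mul, map_mul, ha, hb]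
  | hadd a b ha hb => rw [map_add, map_add, ha, hb]

theorem inl_mul_inl (i j : Fin n) :
    x k n (.inl i) * x k n (.inl j) = x k n (.inl j) * x k n (.inl i) := by
  simpa [weylForm, sub_eq_zero] using commutator k n (.inl i) (.inl j)

theorem inr_mul_inr (i j : Fin n) :
    x k n (.inr i) * x k n (.inr j) = x k n (.inr j) * x k n (.inr i) := by
  simpa [weylForm, sub_eq_zero] using commutator k n (.inr i) (.inr j)

theorem inr_mul_inl_self (i : Fin n) :
    x k n (.inr i) * x k n (.inl i) = x k n (.inl i) * x k n (.inr i) + 1 := by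
  simpa [weylForm, sub_eq_iff_eq_add'] using commutator k n (.inr i) (.inl i)

theorem inr_mul_inl_of_ne {i j : Fin n} (h : i ≠ j) :
    x k n (.inr i) * x k n (.inl j) = x k n (.inl j) * x k n (.inr i) := by
  simpa [weylForm, sub_eq_zero, h] using commutator k n (.inr i) (.inl j)

theorem algebraMap_center_C (r : k) :
    algebraMap (WeylCenter k n) (WeylAlgebra k n) (MvPolynomial.C r) = algebraMap k _ r :=
  congrArg Subtype.val ((WeylCenter.toCenter k n).commutes r)

variable (k n) in
/-- The symbol algebra over `Z_n(k)` with `uᵢᵖ = zᵢ` and `vᵢᵖ = c zₙ₊ᵢ`, for an arbitrary scalar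
`c`. -/
abbrev Symbol (c : k) : Type u :=
  SymbolAlgebra (R := WeylCenter k n) (ringChar k) (fun i : Fin n => MvPolynomial.X (.inl i))
    (fun i : Fin n => MvPolynomial.C c * MvPolynomial.X (.inr i))

theorem omegaBar_C (c : kˣ) (r : k) :
    WeylCenter.omegaBar n c (MvPolynomial.C r) = MvPolynomial.C r :=
  (WeylCenter.omegaBar n c).commutes r

theorem omegaBar_X (c : kˣ) (i : Fin n ⊕ Fin n) :
    WeylCenter.omegaBar n c (MvPolynomial.X i) =
      MvPolynomial.C (WeylCenter.scale n c i) * MvPolynomial.X i :=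
  MvPolynomial.aeval_X _ i

/-- The Weyl algebra is a symbol algebra, semilinearly over the rescaling of the center by `c`. -/
theorem exists_ringEquiv_symbol (c : kˣ) :
    ∃ e : WeylAlgebra k n ≃+* Symbol k n (c : k), ∀ r,
      e (algebraMap (WeylCenter k n) _ (WeylCenter.omegaBar n c r)) = algebraMap _ _ r := by
  let σ := (WeylCenter.omegaBar n c).toRingEquiv
  let W := Symbol k n (c : k)
  let : Algebra k W := Algebra.compHom W (algebraMap k (WeylCenter k n))
  have hkW : ∀ r : k, algebraMap k W r = algebraMap (WeylCenter k n) W (MvPolynomial.C r) :=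
    fun r => rfl
  have hW := SymbolAlgebra.isWeylSystem (R := WeylCenter k n) (ringChar k)
    (fun i : Fin n => MvPolynomial.X (.inl i))
    (fun i : Fin n => MvPolynomial.C (c : k) * MvPolynomial.X (.inr i))
  let g : WeylAlgebra k n →ₐ[k] W := lift (Sum.elim
      (SymbolAlgebra.u (R := WeylCenter k n) (ringChar k) _ _) (SymbolAlgebra.v (ringChar k) _ _)) (by
    rintro (i | i) (j | j)
    · simpa [weylForm, sub_eq_zero] using hW.uu i j
    · by_cases h : i = j
      · subst h; simp [weylForm, hW.vu_self i]
      · simpa [weylForm, h, sub_eq_zero] using (hW.vu_ne j i (Ne.symm h)).symm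
    · by_cases h : i = j
      · subst h; simp [weylForm, hW.vu_self i]
      · simpa [weylForm, h, sub_eq_zero] using hW.vu_ne i j h
    · simpa [weylForm, sub_eq_zero] using hW.vv i j)
  have hσ : ∀ r, algebraMap (WeylCenter k n) (Twist σ (WeylAlgebra k n)) r =
    algebraMap (WeylCenter k n) (WeylAlgebra k n) (WeylCenter.omegaBar n c r) := fun r => rfl
  let f : W →ₐ[WeylCenter k n] Twist σ (WeylAlgebra k n) := SymbolAlgebra.lift
    (u := fun i => Twist.of σ _ (x k n (.inl i))) (v := fun i => Twist.of σ _ (x k n (.inr i)))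
    { uu := fun i j => inl_mul_inl i j
      vv := fun i j => inr_mul_inr i j
      vu_self := fun i => inr_mul_inl_self i
      vu_ne := fun i j h => inr_mul_inl_of_ne h
      u_pow := fun i => by
        rw [hσ, omegaBar_X, map_mul, algebraMap_center_C, WeylCenter.algebraMap_X]
        simp [WeylCenter.scale]
        rfl
      v_pow := fun i => by
        rw [hσ, map_mul, omegaBar_X, omegaBar_C, ← mul_assoc, ← map_mul, map_mul,
          algebraMap_center_C, WeylCenter.algebraMap_X]
        simp [WeylCenter.scale]
        rfl }
  have hg : ∀ r, g (algebraMap (WeylCenter k n) _ (WeylCenter.omegaBar n c r)) =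
      algebraMap _ W r := by
    refine DFunLike.congr_fun (MvPolynomial.ringHom_ext
      (f := (g.toRingHom.comp (algebraMap _ _)).comp (WeylCenter.omegaBar n c).toRingHom) ?_ ?_)
    · intro r
      change g (algebraMap (WeylCenter k n) _ (WeylCenter.omegaBar n c (MvPolynomial.C r))) = _
      rw [omegaBar_C, algebraMap_center_C, AlgHom.commutes, hkW]
    · rintro (i | i)
      · change g (algebraMap (WeylCenter k n) _ (WeylCenter.omegaBar n c (MvPolynomial.X _))) = _
        rw [omegaBar_X, map_mul, algebraMap_center_C, WeylCenter.algebraMap_X, map_mul, map_pow,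
          lift_x, ← hW.u_pow i]
        simp [WeylCenter.scale]
      · change g (algebraMap (WeylCenter k n) _ (WeylCenter.omegaBar n c (MvPolynomial.X _))) = _
        rw [omegaBar_X, map_mul, algebraMap_center_C, WeylCenter.algebraMap_X, map_mul, map_pow,
          lift_x, AlgHom.commutes, hkW]
        change _ * SymbolAlgebra.v (ringChar k) _ _ i ^ ringChar k = _
        rw [hW.v_pow i, ← map_mul, ← mul_assoc, ← map_mul]
        simp [WeylCenter.scale]
  refine ⟨RingEquiv.ofRingHom g.toRingHom
    (((Twist.of σ (WeylAlgebra k n)).symm : _ →+* _).comp f.toRingHom) ?_ ?_, hg⟩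
  · ext w
    change g ((Twist.of σ (WeylAlgebra k n)).symm (f w)) = w
    induction w using SymbolAlgebra.induction with
    | hr r => rw [AlgHom.commutes]; exact hg r
    | hu i => rw [SymbolAlgebra.lift_u, RingEquiv.symm_apply_apply, lift_x]; rfl
    | hv i => rw [SymbolAlgebra.lift_v, RingEquiv.symm_apply_apply, lift_x]; rfl
    | hmul a b ha hb => rw [map_mul, map_mul, map_mul, ha, hb]
    | hadd a b ha hb => rw [map_add, map_add, map_add, ha, hb]
  · refine ringHom_ext ?_ ?_
    · intro r
      change (Twist.of σ (WeylAlgebra k n)).symm (f (g (algebraMap k _ r))) = algebraMap k _ r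
      rw [AlgHom.commutes, hkW, AlgHom.commutes, hσ, omegaBar_C, algebraMap_center_C]
      rfl
    · rintro (i | i)
      · change (Twist.of σ (WeylAlgebra k n)).symm (f (g _)) = _
        rw [lift_x]
        exact congrArg _ (SymbolAlgebra.lift_u _ i)
      · change (Twist.of σ (WeylAlgebra k n)).symm (f (g _)) = _
        rw [lift_x]
        exact congrArg _ (SymbolAlgebra.lift_v _ i)

/-- The pushforward of the Weyl algebra along `ω(c)` is a symbol algebra. -/
theorem nonempty_pushforward_algEquiv (c : kˣ) :
    Nonempty (Pushforward (WeylCenter.omega n c) (WeylAlgebra k n) ≃ₐ[WeylCenter k n]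
      Symbol k n (c : k)) := by
  obtain ⟨e, he⟩ := exists_ringEquiv_symbol (n := n) c
  refine ⟨Twist.algEquivOfRingEquiv e fun r => ?_⟩
  rw [← he]
  exact congrArg (fun σ : WeylCenter k n ≃ₐ[k] WeylCenter k n => e (algebraMap _ _ (σ r)))
    (SchemeAut.dual_spec (WeylCenter.omegaBar n c))

/-- The Weyl algebra is a symbol algebra over its center. -/
theorem nonempty_algEquiv_symbol :
    Nonempty (WeylAlgebra k n ≃ₐ[WeylCenter k n] Symbol k n (1 : k)) := by
  obtain ⟨e, he⟩ := exists_ringEquiv_symbol (k := k) (n := n) 1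
  have h : ∀ r, WeylCenter.omegaBar (k := k) n 1 r = r := by
    refine DFunLike.congr_fun (f := (WeylCenter.omegaBar (k := k) n 1).toAlgHom)
      (g := AlgHom.id k _) (MvPolynomial.algHom_ext ?_)
    intro i
    change WeylCenter.omegaBar n 1 (MvPolynomial.X i) = MvPolynomial.X i
    rw [omegaBar_X]
    rcases i with i | i <;> simp [WeylCenter.scale]
  exact ⟨AlgEquiv.ofRingEquiv (f := e) fun r => by simpa [h] using he r⟩

end WeylAlgebra

/-! ### Polynomials of bounded degree and symbols of operators -/

namespace MvPolynomial

variable {σ : Type*} {k : Type*} [CommRing k]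

variable (σ k) in
/-- The polynomials of total degree less than `d`. -/
def degreeLT (d : ℕ) : Submodule k (MvPolynomial σ k) where
  carrier := {f | ∀ s : σ →₀ ℕ, d ≤ s.degree → coeff s f = 0}
  zero_mem' := fun s _ => coeff_zero s
  add_mem' := fun hf hg s hs => by rw [coeff_add, hf s hs, hg s hs, add_zero]
  smul_mem' := fun c f hf s hs => by rw [coeff_smul, hf s hs, smul_zero]

theorem degreeLT_mono {d e : ℕ} (h : d ≤ e) : degreeLT σ k d ≤ degreeLT σ k e :=
  fun _ hf s hs => hf s (h.trans hs)

theorem eq_zero_of_mem_degreeLT_zero {f : MvPolynomial σ k} (hf : f ∈ degreeLT σ k 0) : f = 0 :=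
  MvPolynomial.ext _ _ fun s => by rw [hf s (Nat.zero_le _), coeff_zero]

theorem monomial_mem_degreeLT (s : σ →₀ ℕ) (c : k) : monomial s c ∈ degreeLT σ k (s.degree + 1) := by
  classical
  intro t ht
  rw [coeff_monomial, if_neg]
  rintro rfl
  omega

theorem mul_mem_degreeLT {f g : MvPolynomial σ k} {m d : ℕ} (hf : f ∈ degreeLT σ k (m + 1))
    (hg : g ∈ degreeLT σ k d) : f * g ∈ degreeLT σ k (m + d) := by
  classical
  intro s hs
  rw [coeff_mul]
  refine Finset.sum_eq_zero fun x hx => ?_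
  rw [Finset.HasAntidiagonal.mem_antidiagonal] at hx
  rw [← hx, map_add] at hs
  by_cases h : m + 1 ≤ x.1.degree
  · rw [hf _ h, zero_mul]
  · rw [hg _ (by omega), mul_zero]

theorem pderiv_mem_degreeLT {f : MvPolynomial σ k} {d : ℕ} (hf : f ∈ degreeLT σ k (d + 1)) (i : σ) :
    pderiv i f ∈ degreeLT σ k d := by
  intro s hs
  rw [coeff_pderiv, hf, zero_mul]
  rw [map_add, Finsupp.degree_single]
  omega

theorem notMem_degreeLT_totalDegree {f : MvPolynomial σ k} (hf : f ≠ 0) :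
    f ∉ degreeLT σ k f.totalDegree := by
  intro h
  obtain ⟨s, hs, hs'⟩ := Finset.exists_mem_eq_sup f.support (support_nonempty.2 hf)
    (fun s => s.sum fun _ e => e)
  exact mem_support_iff.1 hs (h s hs'.le)

/-- The operator `L` has order at most `m` and differs from the multiplication by `f` by terms of
lower order, for the filtration by the degree. -/
structure HasSymbol (L : Module.End k (MvPolynomial σ k)) (m : ℕ) (f : MvPolynomial σ k) : Prop where
  mem : f ∈ degreeLT σ k (m + 1)
  sub_mem : ∀ d, ∀ g ∈ degreeLT σ k (d + 1), L g - f * g ∈ degreeLT σ k (m + d)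

namespace HasSymbol

variable {L L' : Module.End k (MvPolynomial σ k)} {m m' : ℕ} {f f' : MvPolynomial σ k}

theorem mono (h : HasSymbol L m f) (hm : m ≤ m') : HasSymbol L m' f :=
  ⟨degreeLT_mono (by omega) h.mem, fun d g hg => degreeLT_mono (by omega) (h.sub_mem d g hg)⟩

theorem one : HasSymbol (1 : Module.End k (MvPolynomial σ k)) 0 1 := by
  refine ⟨?_, fun d g _ => by simp⟩
  simpa using monomial_mem_degreeLT (0 : σ →₀ ℕ) (1 : k)

theorem zero : HasSymbol (0 : Module.End k (MvPolynomial σ k)) m 0 :=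
  ⟨zero_mem _, fun d g _ => by simp⟩

theorem add (h : HasSymbol L m f) (h' : HasSymbol L' m f') : HasSymbol (L + L') m (f + f') := by
  refine ⟨add_mem h.mem h'.mem, fun d g hg => ?_⟩
  convert add_mem (h.sub_mem d g hg) (h'.sub_mem d g hg) using 1
  rw [LinearMap.add_apply]; ring

theorem smul (h : HasSymbol L m f) (c : k) : HasSymbol (c • L) m (c • f) := by
  refine ⟨Submodule.smul_mem _ c h.mem, fun d g hg => ?_⟩
  convert Submodule.smul_mem _ c (h.sub_mem d g hg) using 1
  rw [LinearMap.smul_apply, smul_sub, smul_mul_assoc]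

theorem apply_mem (h : HasSymbol L m f) {d : ℕ} {g : MvPolynomial σ k} (hg : g ∈ degreeLT σ k d) :
    L g ∈ degreeLT σ k (m + d) := by
  rcases d with _ | d
  · rw [eq_zero_of_mem_degreeLT_zero hg, map_zero]; exact zero_mem _
  · rw [← sub_add_cancel (L g) (f * g)]
    exact add_mem (degreeLT_mono (by omega) (h.sub_mem d g hg)) (mul_mem_degreeLT h.mem hg)

theorem mul (h : HasSymbol L m f) (h' : HasSymbol L' m' f') :
    HasSymbol (L * L') (m + m') (f * f') := by
  refine ⟨degreeLT_mono (by omega) (mul_mem_degreeLT h.mem h'.mem), fun d g hg => ?_⟩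
  have h1 := h.apply_mem (h'.sub_mem d g hg)
  have h2 := h.sub_mem (m' + d) (f' * g) (degreeLT_mono (by omega) (mul_mem_degreeLT h'.mem hg))
  convert add_mem h1 h2 using 1
  · rw [add_assoc]
  · rw [Module.End.mul_apply, map_sub]; ring

theorem sum {ι : Type*} (s : Finset ι) {L : ι → Module.End k (MvPolynomial σ k)}
    {f : ι → MvPolynomial σ k} (h : ∀ i ∈ s, HasSymbol (L i) m (f i)) :
    HasSymbol (∑ i ∈ s, L i) m (∑ i ∈ s, f i) := by
  classical
  induction s using Finset.induction_on with
  | empty => simpa using zero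
  | insert i s hi ih =>
    rw [Finset.sum_insert hi, Finset.sum_insert hi]
    exact (h i (Finset.mem_insert_self i s)).add (ih fun j hj => h j (Finset.mem_insert_of_mem hj))

end HasSymbol

/-- Induction on exponents which raises the exponents outside `T` first. -/
theorem _root_.Finsupp.induction_outside_first (T : Set σ) {Q : (σ →₀ ℕ) → Prop} (zero : Q 0)
    (mem : ∀ s, ∀ i ∈ T, Q s → Q (s + Finsupp.single i 1))
    (notMem : ∀ s, ∀ i ∉ T, (∀ j ∈ T, s j = 0) → Q s → Q (s + Finsupp.single i 1))
    (s : σ →₀ ℕ) : Q s := by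
  induction h : s.degree using Nat.strong_induction_on generalizing s with
  | _ d ih =>
    subst h
    have key : ∀ i, s i ≠ 0 → ∃ t, s = t + Finsupp.single i 1 ∧ Q t := by
      intro i hi
      have hs : s = (s - Finsupp.single i 1) + Finsupp.single i 1 :=
        (tsub_add_cancel_of_le (by
          rw [Finsupp.single_le_iff]; omega)).symm
      refine ⟨_, hs, ih _ ?_ _ rfl⟩
      conv_rhs => rw [hs, map_add, Finsupp.degree_single]
      omega
    by_cases hT : ∃ i ∈ T, s i ≠ 0
    · obtain ⟨i, hi, hsi⟩ := hT
      obtain ⟨t, rfl, ht⟩ := key i hsi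
      exact mem t i hi ht
    · push Not at hT
      by_cases h0 : s = 0
      · rwa [h0]
      · obtain ⟨i, hi⟩ := Finsupp.ne_iff.1 h0
        obtain ⟨t, rfl, ht⟩ := key i hi
        exact notMem t i (fun h => hi (hT i h))
          (fun j hj => by have := hT j hj; rw [Finsupp.add_apply] at this; omega) ht

/-! ### Partial derivatives -/

theorem X_mul_monomial_one (s : σ →₀ ℕ) (i : σ) :
    X i * monomial s (1 : k) = monomial (s + Finsupp.single i 1) 1 := by
  rw [X, monomial_mul, one_mul, add_comm]

theorem pderiv_pderiv_comm (i j : σ) (f : MvPolynomial σ k) :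
    pderiv i (pderiv j f) = pderiv j (pderiv i f) := by
  classical
  have : ⁅pderiv (R := k) i, pderiv j⁆ = 0 := derivation_ext fun l => by
    rw [Derivation.commutator_apply]
    simp [pderiv_X, Pi.single_apply, apply_ite]
  have := DFunLike.congr_fun this f
  rwa [Derivation.commutator_apply, Derivation.coe_zero, Pi.zero_apply, sub_eq_zero] at this

theorem pderiv_X_mul (i : σ) (f : MvPolynomial σ k) : pderiv i (X i * f) = X i * pderiv i f + f := by
  rw [Derivation.leibniz, pderiv_X_self, smul_eq_mul, smul_eq_mul, mul_one]

theorem pderiv_X_mul_of_ne {i j : σ} (h : j ≠ i) (f : MvPolynomial σ k) :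
    pderiv i (X j * f) = X j * pderiv i f := by
  rw [Derivation.leibniz, pderiv_X_of_ne h, smul_zero, add_zero, smul_eq_mul]

/-- In characteristic `p` the `p`-th power of a partial derivative vanishes. -/
theorem pderiv_pow_char (p : ℕ) [CharP k p] (hp : 0 < p) (i : σ) :
    ((pderiv (R := k) i).toLinearMap : Module.End k (MvPolynomial σ k)) ^ p = 0 := by
  set D : Module.End k (MvPolynomial σ k) := (pderiv (R := k) i).toLinearMap
  have h0 : (p : Module.End k (MvPolynomial σ k)) = 0 := by
    rw [← map_natCast (algebraMap k _), CharP.cast_eq_zero, map_zero]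
  have hcomm : ∀ j, D ^ p * LinearMap.mulLeft k (X j) = LinearMap.mulLeft k (X j) * D ^ p := by
    intro j
    by_cases hj : j = i
    · subst hj
      rw [pow_mul_of_weyl (T := LinearMap.mulLeft k (X j))
        (LinearMap.ext fun f => pderiv_X_mul j f), h0, zero_mul, add_zero]
    · have : Commute D (LinearMap.mulLeft k (X j)) :=
        LinearMap.ext fun f => pderiv_X_mul_of_ne hj f
      exact this.pow_left p
  refine LinearMap.ext fun f => ?_
  rw [LinearMap.zero_apply]
  induction f using MvPolynomial.induction_on with
  | C c =>
    obtain ⟨q, rfl⟩ := Nat.exists_eq_succ_of_ne_zero hp.ne'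
    rw [pow_succ, Module.End.mul_apply]
    change (D ^ q) (pderiv i (C c)) = 0
    rw [pderiv_C, map_zero]
  | add f g hf hg => rw [map_add, hf, hg, add_zero]
  | mul_X f j hf =>
    have := LinearMap.congr_fun (hcomm j) f
    rw [Module.End.mul_apply, Module.End.mul_apply, hf, map_zero, LinearMap.mulLeft_apply,
      mul_comm] at this
    exact this

end MvPolynomial

/-! ### The Weyl algebra is a domain -/

namespace WeylAlgebra

open MvPolynomial

variable {k : Type u} [Field k] {n : ℕ}

variable (k n) in
/-- The operators on `k[X₁, …, X₂ₙ]` by which the generators of the Weyl algebra act: `Xᵢ` for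
`i ≤ n` and `Xₙ₊ᵢ + ∂ᵢ` for the others. -/
noncomputable def actX : Fin n ⊕ Fin n → Module.End k (MvPolynomial (Fin n ⊕ Fin n) k)
  | .inl i => LinearMap.mulLeft k (X (.inl i))
  | .inr i => LinearMap.mulLeft k (X (.inr i)) + (pderiv (.inl i)).toLinearMap

theorem actX_inl (i : Fin n) (f : MvPolynomial (Fin n ⊕ Fin n) k) :
    actX k n (.inl i) f = X (.inl i) * f := rfl

theorem actX_inr (i : Fin n) (f : MvPolynomial (Fin n ⊕ Fin n) k) :
    actX k n (.inr i) f = X (.inr i) * f + pderiv (.inl i) f := rfl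

variable (k n) in
/-- The left regular representation of the Weyl algebra in normally ordered monomials. -/
noncomputable def act :
    WeylAlgebra k n →ₐ[k] Module.End k (MvPolynomial (Fin n ⊕ Fin n) k) :=
  lift (actX k n) (by
    have hii : ∀ i j : Fin n, ∀ f, pderiv (R := k) (.inl i) (X (Sum.inl (β := Fin n) j) * f) =
        X (.inl j) * pderiv (.inl i) f + if i = j then f else 0 := by
      intro i j f
      by_cases h : i = j
      · subst h; rw [pderiv_X_mul, if_pos rfl]
      · rw [pderiv_X_mul_of_ne (by simpa using Ne.symm h), if_neg h, add_zero]
    rintro (i | i) (j | j) <;> refine LinearMap.ext fun f => ?_ <;>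
      simp only [LinearMap.sub_apply, Module.End.mul_apply, actX_inl, actX_inr, map_add, hii,
        Module.algebraMap_end_apply, weylForm, zero_smul,
        pderiv_X_mul_of_ne (show (Sum.inr (α := Fin n) (β := Fin n) _) ≠ Sum.inl _ by simp)]
    · ring
    · by_cases h : i = j <;> simp [h, eq_comm (a := j)] <;> ring
    · by_cases h : i = j <;> simp [h] <;> ring
    · rw [pderiv_pderiv_comm]; ring)

theorem act_x (i : Fin n ⊕ Fin n) : act k n (x k n i) = actX k n i := lift_x _ _ i

theorem act_mul_apply (a b : WeylAlgebra k n) (f : MvPolynomial (Fin n ⊕ Fin n) k) :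
    act k n (a * b) f = act k n a (act k n b f) := by rw [map_mul]; rfl

/-- The left action commutes with right multiplication by `xₙ₊ᵢ`, which is multiplication by `Xₙ₊ᵢ` in
normally ordered monomials. -/
theorem act_X_inr_mul (a : WeylAlgebra k n) (i : Fin n) (f : MvPolynomial (Fin n ⊕ Fin n) k) :
    act k n a (X (.inr i) * f) = X (.inr i) * act k n a f := by
  induction a using induction generalizing f with
  | hr r => simp [Module.algebraMap_end_apply]
  | hx j =>
    rw [act_x]
    rcases j with j | j
    · rw [actX_inl, actX_inl]; ring
    · rw [actX_inr, actX_inr, pderiv_X_mul_of_ne (by simp)]; ring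
  | hmul a b ha hb => rw [act_mul_apply, act_mul_apply, hb, ha]
  | hadd a b ha hb => rw [map_add, LinearMap.add_apply, LinearMap.add_apply, ha, hb, mul_add]

/-- The left action commutes with right multiplication by `xᵢ` for `i ≤ n`, which is `Xᵢ + ∂ₙ₊ᵢ` in
normally ordered monomials. -/
theorem act_X_inl_mul_add (a : WeylAlgebra k n) (i : Fin n)
    (f : MvPolynomial (Fin n ⊕ Fin n) k) :
    act k n a (X (.inl i) * f + pderiv (.inr i) f) =
      X (.inl i) * act k n a f + pderiv (.inr i) (act k n a f) := by
  induction a using induction generalizing f with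
  | hr r => simp [Module.algebraMap_end_apply]
  | hx j =>
    rw [act_x]
    rcases j with j | j
    · rw [actX_inl, actX_inl, pderiv_X_mul_of_ne (by simp)]; ring
    · rw [actX_inr, actX_inr, map_add, map_add, pderiv_pderiv_comm (Sum.inl j) (Sum.inr i)]
      by_cases h : i = j
      · subst h; rw [pderiv_X_mul, pderiv_X_mul]; ring
      · rw [pderiv_X_mul_of_ne (by simpa using h), pderiv_X_mul_of_ne (by simpa using Ne.symm h)]
        ring
  | hmul a b ha hb => rw [act_mul_apply, act_mul_apply, hb, ha]
  | hadd a b ha hb =>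
    rw [map_add (act k n) a b, LinearMap.add_apply, LinearMap.add_apply, ha, hb, map_add]; ring

/-- The polynomial `1` generates the whole polynomial ring under right multiplications, which commute
with the left action. -/
theorem act_eq_zero_of_act_one_eq_zero {a : WeylAlgebra k n} (ha : act k n a 1 = 0) :
    act k n a = 0 := by
  refine (basisMonomials (Fin n ⊕ Fin n) k).ext fun s => ?_
  rw [coe_basisMonomials, LinearMap.zero_apply]
  change act k n a (monomial s 1) = 0
  induction s using Finsupp.induction_outside_first (Set.range Sum.inr) with
  | zero => exact ha
  | mem s i hi hs =>
    obtain ⟨i, rfl⟩ := hi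
    rw [← X_mul_monomial_one, act_X_inr_mul, hs, mul_zero]
  | notMem s i hi hT hs =>
    rcases i with i | i
    · have h := act_X_inl_mul_add a i (monomial s 1)
      rw [pderiv_monomial, hT _ ⟨i, rfl⟩, Nat.cast_zero, mul_zero, monomial_zero, add_zero,
        X_mul_monomial_one, hs, mul_zero, map_zero, add_zero] at h
      exact h
    · exact absurd ⟨i, rfl⟩ hi

/-- Every polynomial is the value at `1` of an operator in the image of the Weyl algebra which has
that polynomial as its symbol. -/
theorem exists_act_one_eq_and_hasSymbol (f : MvPolynomial (Fin n ⊕ Fin n) k) :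
    ∃ a : WeylAlgebra k n, act k n a 1 = f ∧ HasSymbol (act k n a) f.totalDegree f := by
  have hX : ∀ i, HasSymbol (act k n (x k n i)) 1 (X i) := by
    intro i
    rw [act_x]
    refine ⟨?_, fun d g hg => ?_⟩
    · have h := monomial_mem_degreeLT (Finsupp.single i 1) (1 : k)
      rwa [Finsupp.degree_single] at h
    rcases i with i | i
    · rw [actX_inl, sub_self]; exact zero_mem _
    · rw [actX_inr, add_sub_cancel_left]
      exact degreeLT_mono (by omega) (pderiv_mem_degreeLT hg _)
  have hmon : ∀ s : Fin n ⊕ Fin n →₀ ℕ, ∃ a : WeylAlgebra k n,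
      act k n a 1 = monomial s 1 ∧ HasSymbol (act k n a) s.degree (monomial s 1) := by
    have step : ∀ (s : Fin n ⊕ Fin n →₀ ℕ) i (a : WeylAlgebra k n),
        HasSymbol (act k n a) s.degree (monomial s 1) →
        HasSymbol (act k n (x k n i * a)) (s + Finsupp.single i 1).degree
          (monomial (s + Finsupp.single i 1) 1) := by
      intro s i a ha
      rw [map_mul, ← X_mul_monomial_one, map_add, Finsupp.degree_single, add_comm]
      exact (hX i).mul ha
    intro s
    induction s using Finsupp.induction_outside_first (Set.range Sum.inl) with
    | zero => exact ⟨1, by rw [map_one (act k n)]; rfl, by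
        rw [map_one (act k n), map_zero]; exact .one⟩
    | mem s i hi hs =>
      obtain ⟨i, rfl⟩ := hi
      obtain ⟨a, ha, ha'⟩ := hs
      refine ⟨x k n (.inl i) * a, ?_, step s _ a ha'⟩
      rw [act_mul_apply, ha, act_x, actX_inl, X_mul_monomial_one]
    | notMem s i hi hT hs =>
      obtain ⟨a, ha, ha'⟩ := hs
      rcases i with i | i
      · exact absurd ⟨i, rfl⟩ hi
      · refine ⟨x k n (.inr i) * a, ?_, step s _ a ha'⟩
        rw [act_mul_apply, ha, act_x, actX_inr, X_mul_monomial_one, pderiv_monomial,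
          hT _ ⟨i, rfl⟩, Nat.cast_zero, mul_zero, monomial_zero, add_zero]
  choose a ha ha' using hmon
  have hf : ∑ s ∈ f.support, coeff s f • monomial s (1 : k) = f := by
    conv_rhs => rw [f.as_sum]
    exact Finset.sum_congr rfl fun s _ => by rw [smul_monomial, smul_eq_mul, mul_one]
  refine ⟨∑ s ∈ f.support, coeff s f • a s, ?_, ?_⟩
  · simp only [map_sum, map_smul, LinearMap.sum_apply, LinearMap.smul_apply, ha, hf]
  · have h := HasSymbol.sum (m := f.totalDegree) f.support
      (L := fun s => coeff s f • act k n (a s)) (f := fun s => coeff s f • monomial s (1 : k))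
      fun s hs => ((ha' s).mono (le_totalDegree hs)).smul _
    rw [hf] at h
    simpa only [map_sum, map_smul] using h

/-- The center acts through `zᵢ ↦ Xᵢᵖ`, because `∂ᵢᵖ = 0`. -/
theorem act_algebraMap_center (hp : 0 < ringChar k) (z : WeylCenter k n)
    (f : MvPolynomial (Fin n ⊕ Fin n) k) :
    act k n (algebraMap (WeylCenter k n) _ z) f = expand (ringChar k) z * f := by
  have : Fact (ringChar k).Prime := ⟨CharP.char_prime_of_ne_zero k hp.ne'⟩
  have hpow : ∀ g : MvPolynomial (Fin n ⊕ Fin n) k, ∀ m : ℕ, ∀ f,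
      (LinearMap.mulLeft k g ^ m : Module.End k _) f = g ^ m * f := by
    intro g m f
    rw [LinearMap.pow_mulLeft, LinearMap.mulLeft_apply]
  have hX : ∀ i f, act k n (x k n i ^ ringChar k) f = X i ^ ringChar k * f := by
    intro i f
    rw [map_pow, act_x]
    rcases i with i | i
    · exact hpow _ _ _
    · have hc : LinearMap.mulLeft k (X (.inr i) : MvPolynomial (Fin n ⊕ Fin n) k) *
          (pderiv (.inl i)).toLinearMap =
            (pderiv (.inl i)).toLinearMap * LinearMap.mulLeft k (X (.inr i)) :=
        LinearMap.ext fun f => (pderiv_X_mul_of_ne (by simp) f).symm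
      have h := add_pow_of_commute_of_algebra (R := k) (p := ringChar k) hc
      rw [pderiv_pow_char _ hp, add_zero] at h
      exact (LinearMap.congr_fun h f).trans (hpow _ _ _)
  induction z using MvPolynomial.induction_on generalizing f with
  | C c =>
    rw [algebraMap_center_C, AlgHom.commutes, expand_C, Module.algebraMap_end_apply,
      smul_eq_C_mul]
  | add z w hz hw => rw [map_add, map_add, map_add, LinearMap.add_apply, hz, hw, add_mul]
  | mul_X z i hz =>
    rw [map_mul, act_mul_apply, WeylCenter.algebraMap_X, hX, hz, map_mul, expand_X, mul_assoc]

/-- The kernel is a two-sided ideal, hence stable under all `Z_n(k)`-linear endomorphisms by the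
Azumaya property; if it were nonzero, a coordinate functional would map it to a nonzero central
element, which acts nontrivially. -/
theorem act_injective (hpos : 0 < ringChar k) (hchar : ringChar k ≠ 2) :
    Function.Injective (act k n) := by
  have hp : (ringChar k).Prime := CharP.char_prime_of_ne_zero k hpos.ne'
  have : Fact (ringChar k).Prime := ⟨hp⟩
  obtain ⟨e⟩ := nonempty_algEquiv_symbol (k := k) (n := n)
  obtain ⟨h1, h2⟩ := SymbolAlgebra.free_and_isAzumaya (R := WeylCenter k n) (p := ringChar k)
    (hp.odd_of_ne_two hchar) (Fin n) (fun i => X (.inl i)) (fun i => C 1 * X (.inr i))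
  have : Module.Free (WeylCenter k n) (WeylAlgebra k n) := .of_equiv e.symm.toLinearEquiv
  have : IsAzumaya (WeylCenter k n) (WeylAlgebra k n) := .of_AlgEquiv _ _ _ e.symm
  rw [injective_iff_map_eq_zero]
  intro a ha
  by_contra h0
  let B := Module.Free.chooseBasis (WeylCenter k n) (WeylAlgebra k n)
  obtain ⟨i, hi⟩ : ∃ i, B.coord i a ≠ 0 := by
    by_contra! h
    exact h0 (B.forall_coord_eq_zero_iff.1 h)
  obtain ⟨t, ht⟩ := (IsAzumaya.bij (R := WeylCenter k n) (A := WeylAlgebra k n)).2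
    ((Algebra.linearMap _ _).comp (B.coord i))
  have key : ∀ t, act k n (AlgHom.mulLeftRight (WeylCenter k n) (WeylAlgebra k n) t a) = 0 := by
    intro t
    induction t with
    | zero => rw [map_zero, LinearMap.zero_apply, map_zero]
    | add t t' h h' => rw [map_add, LinearMap.add_apply, map_add, h, h', add_zero]
    | tmul b c => rw [AlgHom.mulLeftRight_apply, map_mul, map_mul, ha, mul_zero, zero_mul]
  have h3 := key t
  rw [ht, LinearMap.comp_apply, Algebra.linearMap_apply] at h3
  have h4 := LinearMap.congr_fun h3 1
  rw [act_algebraMap_center hpos, mul_one, LinearMap.zero_apply, expand_eq_zero hpos] at h4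
  exact hi h4

/-- The symbols of two nonzero elements have nonzero product, so the elements do too. -/
theorem noZeroDivisors (hpos : 0 < ringChar k) (hchar : ringChar k ≠ 2) :
    NoZeroDivisors (WeylAlgebra k n) := by
  have hinj : ∀ a : WeylAlgebra k n, act k n a 1 = 0 → a = 0 := fun a ha =>
    act_injective hpos hchar ((act_eq_zero_of_act_one_eq_zero ha).trans (map_zero _).symm)
  have hsymb : ∀ a : WeylAlgebra k n,
      HasSymbol (act k n a) (act k n a 1).totalDegree (act k n a 1) := by
    intro a
    obtain ⟨b, hb, hb'⟩ := exists_act_one_eq_and_hasSymbol (act k n a 1)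
    have : b - a = 0 := hinj _ (by rw [map_sub, LinearMap.sub_apply, hb, sub_self])
    rwa [sub_eq_zero.1 this] at hb'
  refine ⟨fun {a b} hab => ?_⟩
  by_contra! h
  have ha : act k n a 1 ≠ 0 := fun h' => h.1 (hinj a h')
  have hb : act k n b 1 ≠ 0 := fun h' => h.2 (hinj b h')
  have hmul := ((hsymb a).mul (hsymb b)).sub_mem 0 1 HasSymbol.one.mem
  rw [← map_mul, hab, map_zero, LinearMap.zero_apply, mul_one, zero_sub, neg_mem_iff, add_zero,
    ← totalDegree_mul_of_isDomain ha hb] at hmul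
  exact notMem_degreeLT_totalDegree (mul_ne_zero ha hb) hmul

end WeylAlgebra

/-! ### Reduced split Azumaya algebras over a domain are commutative -/

/-- A reduced torsion-free algebra over a domain whose Brauer class is trivial is commutative.

If `B ⊗ End V ≅ End W`, take `E = v₀ ⊗ φ` in `End V` with `φ v₀ ≠ 0`. The operators
`(1 ⊗ E) T (1 ⊗ E)` on `W` all come from elements `b ⊗ E`, so none of them is a nonzero nilpotent.
For `T` of rank one this says that `(1 ⊗ E) W` has rank one, and `B` acts faithfully on it. -/
theorem BrauerEquiv.mul_comm_of_isReduced {Z B : Type u} [CommRing Z] [IsDomain Z] [Ring B]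
    [Algebra Z B] [IsReduced B] [Nontrivial B] [Module.IsTorsionFree Z B]
    (h : BrauerEquiv Z B Z) (b c : B) : b * c = c * b := by
  obtain ⟨V, W, _, _, _, _, ⟨_, _, hV⟩, ⟨_, _, _⟩, ⟨e₀⟩⟩ := h
  let e : B ⊗[Z] Module.End Z V ≃ₐ[Z] Module.End Z W :=
    e₀.trans (Algebra.TensorProduct.lid Z (Module.End Z W))
  obtain ⟨v₀, hv₀⟩ : ∃ v : V, v ≠ 0 := by
    by_contra! hV0
    exact one_ne_zero (hV.eq_of_smul_eq_smul (m₁ := (1 : Z)) (m₂ := 0)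
      fun v => by rw [hV0 v, smul_zero, smul_zero])
  obtain ⟨φ, hφ⟩ : ∃ φ : Module.Dual Z V, φ v₀ ≠ 0 := by
    by_contra! hφ
    exact hv₀ ((Module.forall_dual_apply_eq_zero_iff Z v₀).1 hφ)
  let E : Module.End Z V := φ.smulRight v₀
  have hE : ∀ T : Module.End Z V, E * T * E = φ (T v₀) • E := fun T => LinearMap.ext fun v => by
    simp [E, smul_smul, mul_comm]
  -- `b ↦ b ⊗ E` is injective, since `b ⊗ T ↦ φ (T v₀) b` retracts it up to a nonzero scalar
  have hinj : ∀ d : B, d ⊗ₜ[Z] E = 0 → d = 0 := by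
    intro d hd
    have h1 := congrArg (TensorProduct.lift ((LinearMap.lsmul Z B).flip.compl₂
      (φ ∘ₗ LinearMap.applyₗ v₀))) hd
    rw [map_zero, TensorProduct.lift.tmul] at h1
    have h2 : (φ v₀ * φ v₀) • d = 0 := by simpa [E] using h1
    exact (smul_eq_zero.1 h2).resolve_left (mul_ne_zero hφ hφ)
  set ε : Module.End Z W := e (1 ⊗ₜ E) with hε
  have hcorner : ∀ T : Module.End Z W, ∃ d : B, ε * T * ε = e (d ⊗ₜ E) := by
    intro T
    obtain ⟨t, rfl⟩ := e.surjective T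
    rw [hε, ← map_mul, ← map_mul]
    induction t with
    | zero => exact ⟨0, by simp⟩
    | tmul d T =>
      refine ⟨φ (T v₀) • d, ?_⟩
      rw [Algebra.TensorProduct.tmul_mul_tmul, Algebra.TensorProduct.tmul_mul_tmul, one_mul, mul_one,
        hE, TensorProduct.tmul_smul, TensorProduct.smul_tmul']
    | add t t' ht ht' =>
      obtain ⟨d, hd⟩ := ht
      obtain ⟨d', hd'⟩ := ht'
      exact ⟨d + d', by rw [mul_add, add_mul, map_add, hd, hd', TensorProduct.add_tmul, map_add]⟩
  have hEE : E * E = φ v₀ • E := by simpa using hE 1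
  have hεε : ∀ w, ε (ε w) = φ v₀ • ε w := by
    intro w
    rw [← Module.End.mul_apply, hε, ← map_mul, Algebra.TensorProduct.tmul_mul_tmul, one_mul, hEE,
      TensorProduct.tmul_smul, map_smul]
    rfl
  have hrank : ∀ (ψ : Module.Dual Z W) (w : W), ψ (ε w) = 0 → ∀ x, ψ (ε x) • ε w = 0 := by
    intro ψ w hw x
    obtain ⟨d, hd⟩ := hcorner (ψ.smulRight w)
    have hd' : ∀ x, e (d ⊗ₜ E) x = ψ (ε x) • ε w := fun x => by rw [← hd]; simp
    have h2 : (d * d) ⊗ₜ[Z] E = 0 := by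
      have h3 : φ v₀ • ((d * d) ⊗ₜ[Z] E) = 0 := by
        rw [← TensorProduct.tmul_smul, ← hEE, ← Algebra.TensorProduct.tmul_mul_tmul]
        apply e.injective
        rw [map_mul, map_zero]
        refine LinearMap.ext fun y => ?_
        rw [Module.End.mul_apply, hd', hd', map_smul, map_smul, hεε, map_smul, hw]
        simp
      have h4 : (φ v₀ • (d * d)) ⊗ₜ[Z] E = 0 := by rwa [← TensorProduct.smul_tmul']
      rw [(smul_eq_zero.1 (hinj _ h4)).resolve_left hφ, TensorProduct.zero_tmul]
    have h5 : d = 0 := by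
      have := hinj _ h2
      exact IsReduced.eq_zero d ⟨2, by rw [pow_two, this]⟩
    rw [← hd', h5, TensorProduct.zero_tmul, map_zero, LinearMap.zero_apply]
  obtain ⟨w₀, hw₀⟩ : ∃ w, ε w ≠ 0 := by
    by_contra! h0
    refine one_ne_zero (hinj (1 : B) (e.injective ?_))
    rw [map_zero]
    exact LinearMap.ext h0
  obtain ⟨ψ, hψ⟩ : ∃ ψ : Module.Dual Z W, ψ (ε w₀) ≠ 0 := by
    by_contra! hψ
    exact hw₀ ((Module.forall_dual_apply_eq_zero_iff Z _).1 hψ)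
  have hline : ∀ y, ψ (ε w₀) • ε y = ψ (ε y) • ε w₀ := by
    intro y
    have h1 := hrank ψ (ψ (ε w₀) • y - ψ (ε y) • w₀) (by
      simp only [map_sub, map_smul, smul_eq_mul]; ring) w₀
    have h2 := (smul_eq_zero.1 h1).resolve_left hψ
    rwa [map_sub, map_smul, map_smul, sub_eq_zero] at h2
  let τ : B →ₐ[Z] Module.End Z W := e.toAlgHom.comp Algebra.TensorProduct.includeLeft
  have hτ : ∀ d w, τ d (ε w) = e (d ⊗ₜ E) w := by
    intro d w
    change (e (d ⊗ₜ 1) * e (1 ⊗ₜ E)) w = _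
    rw [← map_mul, Algebra.TensorProduct.tmul_mul_tmul, one_mul, mul_one]
  have hτ' : ∀ d w, τ d (ε w) = ε (τ d w) := by
    intro d w
    rw [hτ]
    change _ = (e (1 ⊗ₜ E) * e (d ⊗ₜ 1)) w
    rw [← map_mul, Algebra.TensorProduct.tmul_mul_tmul, one_mul, mul_one]
  have hprod : ∀ b c : B, (ψ (ε w₀) * ψ (ε w₀)) • τ (b * c) (ε w₀) =
      (ψ (ε (τ b w₀)) * ψ (ε (τ c w₀))) • ε w₀ := by
    intro b c
    rw [map_mul, Module.End.mul_apply, hτ' c, mul_smul, ← map_smul, hline, map_smul, hτ' b,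
      smul_comm, hline, smul_smul, mul_comm]
  have h0 : τ (b * c - c * b) (ε w₀) = 0 := by
    have h1 : (ψ (ε w₀) * ψ (ε w₀)) • τ (b * c - c * b) (ε w₀) = 0 := by
      rw [map_sub, LinearMap.sub_apply, smul_sub, hprod, hprod, mul_comm, sub_self]
    exact (smul_eq_zero.1 h1).resolve_left (mul_ne_zero hψ hψ)
  refine sub_eq_zero.1 (hinj _ (e.injective ?_))
  rw [map_zero]
  refine LinearMap.ext fun y => ?_
  rw [← hτ, LinearMap.zero_apply]
  have h1 : ψ (ε w₀) • τ (b * c - c * b) (ε y) = 0 := by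
    rw [← map_smul, hline, map_smul, h0, smul_zero]
  exact (smul_eq_zero.1 h1).resolve_left hψ

/-! ### The Brauer classes of the pushforwards -/

namespace WeylAlgebra

open MvPolynomial

variable {k : Type u} [Field k] {n : ℕ}

theorem symbol_free_and_isAzumaya (hpos : 0 < ringChar k) (hchar : ringChar k ≠ 2) (c : k) :
    Module.Free (WeylCenter k n) (Symbol k n c) ∧ IsAzumaya (WeylCenter k n) (Symbol k n c) := by
  have hp : (ringChar k).Prime := CharP.char_prime_of_ne_zero k hpos.ne'
  have : Fact (ringChar k).Prime := ⟨hp⟩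
  exact SymbolAlgebra.free_and_isAzumaya (hp.odd_of_ne_two hchar) (Fin n) _ _

/-- For `c ≠ 0` the symbol algebra is a noncommutative domain, so its Brauer class is nontrivial. -/
theorem not_brauerEquiv_symbol (hpos : 0 < ringChar k) (hchar : ringChar k ≠ 2) (hn : 1 ≤ n)
    {c : k} (hc : c ≠ 0) : ¬ BrauerEquiv (WeylCenter k n) (Symbol k n c) (WeylCenter k n) := by
  intro h
  obtain ⟨h1, h2⟩ := symbol_free_and_isAzumaya (n := n) hpos hchar c
  obtain ⟨e, -⟩ := exists_ringEquiv_symbol (n := n) (Units.mk0 c hc)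
  have := noZeroDivisors (k := k) (n := n) hpos hchar
  have : NoZeroDivisors (Symbol k n c) := e.symm.injective.noZeroDivisors e.symm (map_zero _)
    (map_mul _)
  have : Nontrivial (Symbol k n c) :=
    (FaithfulSMul.algebraMap_injective (WeylCenter k n) (Symbol k n c)).nontrivial
  have hW := SymbolAlgebra.isWeylSystem (R := WeylCenter k n) (ringChar k)
    (fun i : Fin n => X (.inl i)) (fun i : Fin n => C c * X (.inr i))
  have h3 := hW.vu_self ⟨0, hn⟩
  rw [h.mul_comm_of_isReduced] at h3
  exact one_ne_zero (left_eq_add.1 h3)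

/-- The homomorphism from the additive group of `k` to the Brauer group sending `c` to the class of
the symbol algebra with parameters `zᵢ`, `c zₙ₊ᵢ`. -/
noncomputable def brauerHom (hpos : 0 < ringChar k) (hchar : ringChar k ≠ 2) :
    Multiplicative k →* Br (WeylCenter k n) :=
  MonoidHom.mk' (fun c => Br.mk _ (Symbol k n c.toAdd)
    (symbol_free_and_isAzumaya hpos hchar c.toAdd).2) fun c d => by
      have hp : (ringChar k).Prime := CharP.char_prime_of_ne_zero k hpos.ne'
      have : Fact (ringChar k).Prime := ⟨hp⟩
      rw [Br.mk_mul_mk, Br.mk_eq_mk_iff]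
      have h := (SymbolAlgebra.brauerEquiv_add (R := WeylCenter k n) (p := ringChar k)
        (hp.odd_of_ne_two hchar) (fun i : Fin n => X (.inl i)) (fun i => C c.toAdd * X (.inr i))
        (fun i => C d.toAdd * X (.inr i))).symm
      have hcd : (fun i : Fin n => (C c.toAdd * X (.inr i) : WeylCenter k n)) +
          (fun i => C d.toAdd * X (.inr i)) = fun i => C (c * d).toAdd * X (.inr i) := by
        funext i
        rw [Pi.add_apply, ← add_mul, ← map_add, toAdd_mul]
      rwa [hcd] at h

theorem brauerHom_injective (hpos : 0 < ringChar k) (hchar : ringChar k ≠ 2) (hn : 1 ≤ n) :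
    Function.Injective (brauerHom (k := k) (n := n) hpos hchar) := by
  rw [injective_iff_map_eq_one]
  intro c hc
  by_contra h0
  exact not_brauerEquiv_symbol hpos hchar hn (c := c.toAdd) h0 ((Br.mk_eq_mk_iff _ _).1 hc)

end WeylAlgebra

theorem BrauerEquiv.matrix_self {R : Type u} [CommRing R] (m : ℕ) [NeZero m] :
    BrauerEquiv R (Matrix (Fin m) (Fin m) R) R :=
  (BrauerEquiv.of_algEquiv Matrix.toLinAlgEquiv').trans (BrauerEquiv.end_self (Fin m → R))

theorem mainTheorem5 (k : Type u) [Field k] (hpos : 0 < ringChar k) (hchar : ringChar k ≠ 2)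
    (n : ℕ) (hn : 1 ≤ n) :
    Function.Injective (algebraMap (WeylCenter k n) (WeylAlgebra k n)) ∧
    Set.range (algebraMap (WeylCenter k n) (WeylAlgebra k n)) = Set.center (WeylAlgebra k n) ∧
    ∃ hA : IsAzumaya (WeylCenter k n) (WeylAlgebra k n),
      (∃ f : Multiplicative k →* Br (WeylCenter k n),
        Function.Injective f ∧
        (∀ c : kˣ, f (Multiplicative.ofAdd (c : k)) =
          Br.mk (WeylCenter k n) (Pushforward (WeylCenter.omega n c) (WeylAlgebra k n))
            (Twist.isAzumaya _ hA)) ∧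
        ∃ hM : IsAzumaya (WeylCenter k n)
            (Matrix (Fin (ringChar k ^ n)) (Fin (ringChar k ^ n)) (WeylCenter k n)),
          f (Multiplicative.ofAdd (0 : k)) = Br.mk (WeylCenter k n) _ hM) ∧
      Function.Injective (fun c : kˣ =>
        (QuotientGroup.mk (WeylCenter.omega n c) :
          SchemeAut k (WeylCenter k n) ⧸ MulAction.stabilizer (SchemeAut k (WeylCenter k n))
            (Br.mk (WeylCenter k n) (WeylAlgebra k n) hA))) := by
  obtain ⟨e⟩ := WeylAlgebra.nonempty_algEquiv_symbol (k := k) (n := n)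
  obtain ⟨h1, h2⟩ := WeylAlgebra.symbol_free_and_isAzumaya (k := k) (n := n) hpos hchar 1
  have : Module.Free (WeylCenter k n) (WeylAlgebra k n) := .of_equiv e.symm.toLinearEquiv
  have hA : IsAzumaya (WeylCenter k n) (WeylAlgebra k n) := .of_AlgEquiv _ _ _ e.symm
  have hf : ∀ c : kˣ, WeylAlgebra.brauerHom hpos hchar (Multiplicative.ofAdd (c : k)) =
      Br.mk (WeylCenter k n) (Pushforward (WeylCenter.omega n c) (WeylAlgebra k n))
        (Twist.isAzumaya _ hA) := by
    intro c
    obtain ⟨e⟩ := WeylAlgebra.nonempty_pushforward_algEquiv (n := n) c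
    exact (Br.mk_eq_mk_iff _ _).2 (.of_algEquiv e.symm)
  refine ⟨FaithfulSMul.algebraMap_injective _ _, ?_, hA, ⟨WeylAlgebra.brauerHom hpos hchar,
    WeylAlgebra.brauerHom_injective hpos hchar hn, hf, ?_⟩, ?_⟩
  · refine Set.Subset.antisymm ?_ fun a ha => ?_
    · rintro _ ⟨r, rfl⟩
      exact Set.algebraMap_mem_center r
    · exact Algebra.mem_bot.1 (Algebra.IsCentral.out (K := WeylCenter k n)
        (Subalgebra.mem_center_iff.2 fun b => (Set.mem_center_iff.1 ha).comm b |>.symm))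
  · have : NeZero (ringChar k ^ n) := ⟨(pow_pos hpos n).ne'⟩
    refine ⟨IsAzumaya.matrix _ _, ?_⟩
    rw [ofAdd_zero, map_one, Br.one_eq, Br.mk_eq_mk_iff]
    exact (BrauerEquiv.matrix_self _).symm
  · intro c d hcd
    rw [QuotientGroup.eq, MulAction.mem_stabilizer_iff, mul_smul, inv_smul_eq_iff, Br.smul_mk,
      Br.smul_mk, ← hf, ← hf] at hcd
    exact Units.ext (Multiplicative.ofAdd.injective
      (WeylAlgebra.brauerHom_injective hpos hchar hn hcd.symm))
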